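/- Let $A$ be a Borel space (a topological space homeomorphic to a Borel subset of a Polish space), with Borel $\sigma$-algebra $\mathcal B(A)$, and let $\rho<1$ be a metric inducing its topology. Let $\lambda$ be a finite measure on $(A,\mathcal B(A))$ with full topological support and let $a_0\in A$. Let $(\Omega',\mathcal F',\mathbb P')$ be a probability space carrying, for $m,n,k\ge 1$, random variables $U^m_n$ uniformly distributed on $(0,1)$, random variables $V^m_n$ exponentially distributed with parameters $\lambda_{nm}>0$ such that $\sum_{n\ge1}\lambda_{nm}^{-1}=1/m$ for every $m$, and Poisson random measures $\pi^k$ on $(0,\infty)\times A$ with intensity $k^{-1}\lambda(da)\,dt$, where all the random elements $U^m_n$, $V^h_j$, $\pi^k$ are independent. Let $(\Omega,\mathcal F,\mathbb P)$ be any probability space with a filtration $\mathbb G=(\mathcal G_t)_{t\ge0}$ (no completeness or right-continuity is required), and put $\hat\Omega=\Omega\times\Omega'$, $\hat{\mathcal F}=\mathcal F\otimes\mathcal F'$, $\mathbb Q=\mathbb P\otimes\mathbb P'$, $\hat{\mathcal G}_t=\{B\times\Omega' : B\in\mathcal G_t\}$. Let $T>0$, let $\alpha:\Omega\times[0,T]\to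 A$ be a $\mathbb G$-progressive process, put $\hat\alpha_t(\omega,\omega')=\alpha_t(\omega)$, and let $\delta>0$. Then there exists on $(\hat\Omega,\hat{\mathcal F},\mathbb Q)$ a marked point process $(\hat S_n,\hat\eta_n)_{n\ge1}$ with values in $(0,\infty)\times A$ and $\hat S_n<\hat S_{n+1}\to\infty$ such that: 1. setting $\hat S_0=0$, $\hat\eta_0=a_0$ and $\hat I_t=\sum_{n\ge0}\hat\eta_n 1_{[\hat S_n,\hat S_{n+1})}(t)$, we have $\mathbb E^{\mathbb Q}\big[\int_0^T\rho(\hat I_t,\hat\alpha_t)\,dt\big]<\delta$; 2. let $\hat\mu=\sum_{n\ge1}\delta_{(\hat S_n,\hat\eta_n)}$, let $\mathbb F^{\hat\mu}$ be its natural filtration, $\mathcal F^{\hat\mu}_t=\sigma(\hat\mu((0,s]\times C):s\le t,\ C\in\mathcal B(A))$, and let $\hat{\mathbb G}\vee\mathbb F^{\hat\mu}=(\hat{\mathcal G}_t\vee\mathcal F^{\hat\mu}_t)_{t\ge0}$. Then each $\hat S_n$ is a stopping time of $\hat{\mathbb G}\vee\mathbb F^{\hat\mu}$ and $\hat\eta_n$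 is measurable for the $\sigma$-algebra of the past of $\hat S_n$, and the $\hat{\mathbb G}\vee\mathbb F^{\hat\mu}$-compensator of $\hat\mu$ under $\mathbb Q$ has the form $\hat\nu_t(\hat\omega,a)\,\lambda(da)\,dt$, where $\hat\nu:\hat\Omega\times[0,\infty)\times A\to[0,\infty)$ is measurable with respect to $\mathcal P(\hat{\mathbb G}\vee\mathbb F^{\hat\mu})\otimes\mathcal B(A)$ ($\mathcal P$ denoting the predictable $\sigma$-algebra) and $$0<\inf_{\hat\Omega\times[0,T]\times A}\hat\nu\le\sup_{\hat\Omega\times[0,T]\times A}\hat\nu<\infty .$$ Here the compensator (dual predictable projection) of $\hat\mu$ is the predictable random measure $\kappa$ on $[0,\infty)\times A$, i.e. the transition kernel for which all processes $\kappa((0,t]\times C)$, $C\in\mathcal B(A)$, are predictable, with $\mathbb E^{\mathbb Q}\int H\,d\hat\mu=\mathbb E^{\mathbb Q}\int H\,d\kappa$ for all nonnegative $\mathcal P(\hat{\mathbb G}\vee\mathbb F^{\hat\mu})\otimes\mathcal B(A)$-measurable $H$. -/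

import Mathlib

open MeasureTheory ProbabilityTheory Filter Topology
open scoped NNReal ENNReal

noncomputable section

/-- A topological space is a *Borel space* if it is homeomorphic to a Borel subset of a Polish
space. -/
def IsBorelTopologicalSpace.{u} (A : Type u) [TopologicalSpace A] : Prop :=
  ∃ (X : Type u) (_ : TopologicalSpace X) (_ : PolishSpace X) (f : A → X),
    Topology.IsEmbedding f ∧ MeasurableSet[borel X] (Set.range f)

/-- Lebesgue measure `dt` on the time axis `[0, ∞)`. -/
def timeMeasure : Measure ℝ≥0 := (volume : Measure ℝ).comap ((↑) : ℝ≥0 → ℝ)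

/-- A process `α`, looked at on the time interval `[0, T]`, is progressive for the filtration `G`:
for all `t ≤ T` the map `(s, ω) ↦ α s ω` on `[0, t] × Ω` is `𝓑([0, t]) ⊗ G t`-measurable. -/
def IsProgressiveUpTo {Ω A : Type*} {mΩ : MeasurableSpace Ω} [MeasurableSpace A]
    (G : Filtration ℝ≥0 mΩ) (T : ℝ≥0) (α : ℝ≥0 → Ω → A) : Prop :=
  ∀ t ≤ T, Measurable[Subtype.instMeasurableSpace.prod (G t)]
    fun p : Set.Iic t × Ω => α p.1 p.2

/-- The distance `E[∫₀ᵀ ρ(β¹ₜ, β²ₜ) dt]` of two measurable `A`-valued processes, where `ρ` is the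
metric of `A`. -/
def krylovDist {Ω A : Type*} [MeasurableSpace Ω] [MetricSpace A] (P : Measure Ω) (T : ℝ≥0)
    (β₁ β₂ : ℝ≥0 → Ω → A) : ℝ≥0∞ :=
  ∫⁻ ω, ∫⁻ t in Set.Iic T, ENNReal.ofReal (dist (β₁ t ω) (β₂ t ω)) ∂timeMeasure ∂P

/-- A non-explosive marked point process with finite arrival times. The `n`-th point, `n ≥ 1`, is
`(time (n - 1), mark (n - 1))`. -/
structure MarkedPointProcess (Ω A : Type*) [MeasurableSpace Ω] [MeasurableSpace A] where
  time : ℕ → Ω → ℝ≥0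
  mark : ℕ → Ω → A
  measurable_time : ∀ n, Measurable (time n)
  measurable_mark : ∀ n, Measurable (mark n)
  time_pos : ∀ n ω, 0 < time n ω
  strictMono_time : ∀ ω, StrictMono fun n => time n ω
  tendsto_time : ∀ ω, Tendsto (fun n => time n ω) atTop atTop

namespace MarkedPointProcess

variable {Ω A : Type*} [mΩ : MeasurableSpace Ω] [MeasurableSpace A]

/-- `N` is a marked point process with respect to the filtration `F`: the arrival times are
stopping times and the marks are measurable for the σ-algebras of the past of these times. -/
def IsAdaptedTo (N : MarkedPointProcess Ω A) (F : Filtration ℝ≥0 mΩ) : Prop :=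
  ∀ n, ∃ h : IsStoppingTime F (fun ω => (N.time n ω : WithTop ℝ≥0)),
    Measurable[h.measurableSpace] (N.mark n)

/-- The random measure `μ = ∑ₙ δ_(Tₙ, Aₙ)` associated with the process. -/
def randomMeasure (N : MarkedPointProcess Ω A) (ω : Ω) : Measure (ℝ≥0 × A) :=
  Measure.sum fun n => Measure.dirac (N.time n ω, N.mark n ω)

lemma measurable_randomMeasure (N : MarkedPointProcess Ω A) {B : Set (ℝ≥0 × A)}
    (hB : MeasurableSet B) : Measurable fun ω => N.randomMeasure ω B := by
  simp only [randomMeasure, Measure.sum_apply _ hB, Measure.dirac_apply' _ hB]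
  refine Measurable.tsum fun n => ?_
  exact (measurable_one.indicator hB).comp ((N.measurable_time n).prodMk (N.measurable_mark n))

/-- The natural filtration `σ(μ((0, s] × C) : s ≤ t, C ∈ 𝓑(A))`, `t ≥ 0`. -/
def naturalFiltration (N : MarkedPointProcess Ω A) : Filtration ℝ≥0 mΩ where
  seq t := ⨆ (s : ℝ≥0) (_ : s ≤ t) (C : Set A) (_ : MeasurableSet C),
    MeasurableSpace.comap (fun ω => N.randomMeasure ω (Set.Ioc 0 s ×ˢ C)) inferInstance
  mono' t t' h := by
    refine iSup₂_le fun s hs => ?_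
    exact le_iSup₂_of_le s (hs.trans h) le_rfl
  le' t := by
    refine iSup₂_le fun s _ => iSup₂_le fun C hC => ?_
    exact (N.measurable_randomMeasure (measurableSet_Ioc.prod hC)).comap_le

/-- The piecewise constant process equal to `a₀` before the first arrival time, and equal on
`[Tₙ, Tₙ₊₁)` to the `n`-th mark: its value at `t` is determined by the number of arrivals up to
time `t`. -/
def stepPath (N : MarkedPointProcess Ω A) (a₀ : A) (t : ℝ≥0) (ω : Ω) : A :=
  match {k : ℕ | N.time k ω ≤ t}.ncard with
  | 0 => a₀
  | n + 1 => N.mark n ω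

lemma stepPath_of_lt (N : MarkedPointProcess Ω A) (a₀ : A) {t : ℝ≥0} {ω : Ω}
    (h : t < N.time 0 ω) : N.stepPath a₀ t ω = a₀ := by
  have : {k : ℕ | N.time k ω ≤ t} = ∅ := by
    ext k
    simpa using h.trans_le ((N.strictMono_time ω).monotone (Nat.zero_le k))
  simp [stepPath, this]

lemma stepPath_of_mem (N : MarkedPointProcess Ω A) (a₀ : A) {t : ℝ≥0} {ω : Ω} {n : ℕ}
    (h : t ∈ Set.Ico (N.time n ω) (N.time (n + 1) ω)) : N.stepPath a₀ t ω = N.mark n ω := by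
  have : {k : ℕ | N.time k ω ≤ t} = (Finset.range (n + 1) : Set ℕ) := by
    ext k
    simp only [Set.mem_ofPred_eq, Finset.coe_range, Set.mem_Iio]
    refine ⟨fun hk => ?_, fun hk => ?_⟩
    · exact (N.strictMono_time ω).lt_iff_lt.1 (hk.trans_lt h.2)
    · exact ((N.strictMono_time ω).monotone (Nat.lt_succ_iff.1 hk)).trans h.1
  simp [stepPath, this]

/-- The waiting times `Tₙ - Tₙ₋₁`, with `T₀ = 0`. -/
def gap (N : MarkedPointProcess Ω A) : ℕ → Ω → ℝ
  | 0, ω => N.time 0 ω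
  | n + 1, ω => (N.time (n + 1) ω : ℝ) - N.time n ω

/-- `N` is, under `P`, a Poisson process with finite intensity measure `lam ≠ 0`: the waiting times
are independent and exponential with parameter `lam A`, the marks are independent with law
`lam / lam A`, and the two sequences are independent. -/
structure IsPoisson (N : MarkedPointProcess Ω A) (P : Measure Ω) (lam : Measure A) : Prop where
  gap_law : ∀ n, HasLaw (N.gap n) (expMeasure (lam.real Set.univ)) P
  mark_law : ∀ n, HasLaw (N.mark n) ((lam Set.univ)⁻¹ • lam) P
  indep_gap : iIndepFun N.gap P
  indep_mark : iIndepFun N.mark P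
  indep_gap_mark : IndepFun (fun ω n => N.gap n ω) (fun ω n => N.mark n ω) P

/-- The σ-algebra generated by all the arrival times and marks. -/
abbrev sigmaAlgebra (N : MarkedPointProcess Ω A) : MeasurableSpace Ω :=
  ⨆ n, MeasurableSpace.comap (N.time n) inferInstance ⊔
    MeasurableSpace.comap (N.mark n) inferInstance

/-- The transition kernel `κ(ω, dt da)` is the compensator (dual predictable projection) of the
random measure `μ` of `N` with respect to `F` and `P`: it is `F`-predictable, i.e. the processes
`κ((0, t] × C)` are `F`-predictable, and `E ∫ H dμ = E ∫ H dκ` for every non-negative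
`𝓟(F) ⊗ 𝓑(A)`-measurable random field `H`. -/
structure IsCompensator (N : MarkedPointProcess Ω A) (F : Filtration ℝ≥0 mΩ) (P : Measure Ω)
    (κ : Ω → Measure (ℝ≥0 × A)) : Prop where
  measurable : ∀ B, MeasurableSet B → Measurable fun ω => κ ω B
  predictable : ∀ C, MeasurableSet C →
    Measurable[F.predictable] fun p : ℝ≥0 × Ω => κ p.2 (Set.Ioc 0 p.1 ×ˢ C)
  smoothing : ∀ H : (ℝ≥0 × Ω) × A → ℝ≥0∞, Measurable[F.predictable.prod inferInstance] H →
    ∫⁻ ω, ∫⁻ x, H ((x.1, ω), x.2) ∂N.randomMeasure ω ∂P =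
      ∫⁻ ω, ∫⁻ x, H ((x.1, ω), x.2) ∂κ ω ∂P

end MarkedPointProcess

/-- The canonical extension `(Gₜ × Ω')ₜ` of a filtration to a product space. -/
def extendFiltration {Ω : Type*} (Ω' : Type*) {mΩ : MeasurableSpace Ω} [MeasurableSpace Ω']
    (G : Filtration ℝ≥0 mΩ) : Filtration ℝ≥0 (mΩ.prod (inferInstance : MeasurableSpace Ω')) where
  seq t := (G t).comap Prod.fst
  mono' _ _ h := MeasurableSpace.comap_mono (G.mono h)
  le' t := (MeasurableSpace.comap_mono (G.le t)).trans le_sup_left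

/-- The random objects carried by the auxiliary probability space `(Ω', P')`: for `m, n, k ≥ 1`,
variables `U^m_n` uniform on `(0, 1)`, variables `V^m_n` exponential with parameter `λ_{nm}`,
where `∑ₙ λ_{nm}⁻¹ = 1 / m`, and Poisson processes `π^k` with intensity `k⁻¹ lam`, all independent.
The indices `m, n, k ≥ 1` are written here as `m + 1, n + 1, k + 1` with `m, n, k : ℕ`. -/
structure AuxiliaryObjects {Ω' A : Type*} [MeasurableSpace Ω'] [MeasurableSpace A]
    (lam : Measure A) (P' : Measure Ω') where
  rate : ℕ → ℕ → ℝ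
  rate_pos : ∀ m n, 0 < rate m n
  hasSum_inv_rate : ∀ m, HasSum (fun n => (rate m n)⁻¹) (1 / ((m : ℝ) + 1))
  U : ℕ → ℕ → Ω' → ℝ
  measurable_U : ∀ m n, Measurable (U m n)
  law_U : ∀ m n, HasLaw (U m n) (volume.restrict (Set.Ioo 0 1)) P'
  V : ℕ → ℕ → Ω' → ℝ
  measurable_V : ∀ m n, Measurable (V m n)
  law_V : ∀ m n, HasLaw (V m n) (expMeasure (rate m n)) P'
  π : ℕ → MarkedPointProcess Ω' A
  poisson_π : ∀ k, (π k).IsPoisson P' (((k : ℝ≥0) + 1)⁻¹ • lam)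
  indep : iIndep (Sum.elim
      (fun p : ℕ × ℕ => MeasurableSpace.comap (U p.1 p.2) inferInstance)
      (Sum.elim (fun p : ℕ × ℕ => MeasurableSpace.comap (V p.1 p.2) inferInstance)
        (fun k : ℕ => (π k).sigmaAlgebra))) P'

end

/-! ### Lebesgue measure on the half-line, reduced to Lebesgue measure on `ℝ`. -/

section TimeMeasure

/-! The control is first replaced by something simple on `Ω`, then imitated by a fast randomly
marked renewal process. Up to a small error in `krylovDist`, `α` may be replaced by a predictable
process `β` with finitely many values, constant on the left-open cells of a time grid
(`exists_predictable_step_approx`). The grid is found by averaging over its shifts and using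
Lebesgue differentiation.

For each point `b` of `A`, a density `p (b, ·)` with respect to `lam` mixes normalized `lam` on a
small ball around `b` with a small multiple of normalized `lam` on all of `A`
(`exists_markDensity`). The ball keeps the mark near `b`, and the global part bounds the density
below. The arrival times are those of a Poisson process with time contracted by a factor `c`. At
each arrival a fresh uniform variable draws the mark from `p (b, ·) lam`, with `b` the current value
of `β`. For small `c` the law of large numbers puts an arrival in the current cell before `t` with
high probability (`tendsto_lintegral_noArrival`). The last mark was then drawn near `β` at `t`,
which gives the estimate `krylovDist_stepPath_renewalMarked_le`.

Exponential gaps have constant hazard rate `r`, and `β`, being predictable, is known just before an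
arrival. The intensity is therefore `r * p (β t, a)` (`isCompensator_renewalMarked`). The proof
works gap by gap: up to the next arrival, a predictable field depends only on time, the mark, the
point of `Ω` and the earlier gaps and uniform variables. These last variables are independent of the
next gap and mark. The lower bound on the intensity is built into `p`; the upper bound holds because
`β` has finite range. -/

lemma measurableEmbedding_coe_nnreal : MeasurableEmbedding ((↑) : ℝ≥0 → ℝ) :=
  MeasurableEmbedding.subtype_coe measurableSet_Ici

lemma setLIntegral_timeMeasure {s : Set ℝ≥0} (φ : ℝ → ℝ≥0∞) :
    ∫⁻ t in s, φ t ∂timeMeasure = ∫⁻ x in ((↑) '' s : Set ℝ), φ x := by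
  have h := measurableEmbedding_coe_nnreal
  have hr : timeMeasure.restrict s
      = ((volume : Measure ℝ).restrict ((↑) '' s : Set ℝ)).comap ((↑) : ℝ≥0 → ℝ) := by
    rw [timeMeasure, h.restrict_comap]
  rw [hr, ← h.lintegral_map, h.map_comap, Measure.restrict_restrict h.measurableSet_range,
    Set.inter_eq_right.2 (Set.image_subset_range _ _)]

lemma image_coe_nnreal_Ioc (a b : ℝ≥0) :
    ((↑) '' Set.Ioc a b : Set ℝ) = Set.Ioc (a : ℝ) b := by
  ext x
  constructor
  · rintro ⟨y, hy, rfl⟩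
    exact ⟨NNReal.coe_lt_coe.2 hy.1, NNReal.coe_le_coe.2 hy.2⟩
  · rintro ⟨h1, h2⟩
    lift x to ℝ≥0 using a.2.trans h1.le
    exact ⟨x, ⟨NNReal.coe_lt_coe.1 h1, NNReal.coe_le_coe.1 h2⟩, rfl⟩

lemma image_coe_nnreal_Iic (b : ℝ≥0) :
    ((↑) '' Set.Iic b : Set ℝ) = Set.Icc (0 : ℝ) b := by
  ext x
  constructor
  · rintro ⟨y, hy, rfl⟩
    exact ⟨y.2, NNReal.coe_le_coe.2 hy⟩
  · rintro ⟨h1, h2⟩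
    lift x to ℝ≥0 using h1
    exact ⟨x, NNReal.coe_le_coe.1 h2, rfl⟩

lemma timeMeasure_Ioc (a b : ℝ≥0) : timeMeasure (Set.Ioc a b) = ((b - a : ℝ≥0) : ℝ≥0∞) := by
  rw [← setLIntegral_one]
  rw [setLIntegral_timeMeasure (fun _ => 1), image_coe_nnreal_Ioc, setLIntegral_one,
    Real.volume_Ioc]
  rw [ENNReal.ofReal, NNReal.sub_def]

lemma timeMeasure_Iic (b : ℝ≥0) : timeMeasure (Set.Iic b) = (b : ℝ≥0∞) := by
  rw [← setLIntegral_one]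
  rw [setLIntegral_timeMeasure (fun _ => 1), image_coe_nnreal_Iic, setLIntegral_one,
    Real.volume_Icc]
  simp

instance : IsFiniteMeasureOnCompacts timeMeasure := by
  refine ⟨fun K hK => ?_⟩
  obtain ⟨b, hb⟩ := hK.bddAbove
  have hK' : K ⊆ Set.Iic b := fun x hx => hb hx
  refine (measure_mono hK').trans_lt ?_
  rw [timeMeasure_Iic]
  exact ENNReal.coe_lt_top

instance : NullSingletonClass timeMeasure := by
  refine ⟨fun x => ?_⟩
  rw [← setLIntegral_one, setLIntegral_timeMeasure (fun _ => 1)]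
  simp

lemma setLIntegral_timeMeasure_Ioc_add (a g : ℝ≥0) {ψ : ℝ≥0 → ℝ≥0∞} :
    ∫⁻ t in Set.Ioc a (a + g), ψ t ∂timeMeasure
      = ∫⁻ x in Set.Ioc (0 : ℝ) g, ψ (a + x.toNNReal) := by
  have h1 : ∫⁻ t in Set.Ioc a (a + g), ψ t ∂timeMeasure
      = ∫⁻ x in Set.Ioc (a : ℝ) (a + g), ψ x.toNNReal := by
    have := setLIntegral_timeMeasure (s := Set.Ioc a (a + g)) (fun x => ψ x.toNNReal)
    simpa only [Real.toNNReal_coe, image_coe_nnreal_Ioc, NNReal.coe_add] using this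
  have h2 : Set.Ioc (0 : ℝ) g = (fun x => (a : ℝ) + x) ⁻¹' Set.Ioc (a : ℝ) (a + g) := by
    ext x; simp
  rw [h1, h2, ← (measurePreserving_add_left (volume : Measure ℝ) (a : ℝ)).setLIntegral_comp_preimage_emb
    (measurableEmbedding_addLeft _)]
  refine setLIntegral_congr_fun ?_ fun x hx => ?_
  · exact (measurable_const_add _) measurableSet_Ioc
  · have : 0 ≤ x := le_of_lt (by simpa using hx.1)
    rw [Real.toNNReal_add a.coe_nonneg this, Real.toNNReal_coe]

end TimeMeasure

/-! ### The predictable σ-algebra and time integrals of predictable processes. -/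

section Predictable

variable {Ω : Type*} {mΩ : MeasurableSpace Ω}

lemma predictable_le_prod (F : Filtration ℝ≥0 mΩ) :
    F.predictable ≤ (inferInstance : MeasurableSpace ℝ≥0).prod mΩ := by
  refine measurableSpace_le_predictable_of_measurableSet (fun B hB => ?_) fun i B hB => ?_
  · exact (measurableSet_singleton _).prod (F.le _ _ hB)
  · exact measurableSet_Ioi.prod (F.le _ _ hB)

lemma measurable_predictable_fst (F : Filtration ℝ≥0 mΩ) :
    Measurable[F.predictable] (Prod.fst : ℝ≥0 × Ω → ℝ≥0) := by
  let : MeasurableSpace (ℝ≥0 × Ω) := F.predictable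
  refine measurable_of_Ioi fun x => ?_
  convert measurableSet_predictable_Ioi_prod (𝓕 := F) (i := x) (s := Set.univ) MeasurableSet.univ
    using 1
  ext p; simp

lemma predictable_mono {F F' : Filtration ℝ≥0 mΩ} (h : F ≤ F') :
    F.predictable ≤ F'.predictable :=
  measurableSpace_le_predictable_of_measurableSet
    (fun _ hB => measurableSet_predictable_singleton_bot_prod (h _ _ hB))
    fun _ _ hB => measurableSet_predictable_Ioi_prod (h _ _ hB)

/-- Generators of different kinds are disjoint, so only intersections within one kind matter. This
makes Dynkin arguments on the predictable σ-algebra available. -/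
lemma isPiSystem_predictable (F : Filtration ℝ≥0 mΩ) :
    IsPiSystem ({s | ∃ A, MeasurableSet[F ⊥] A ∧ s = {⊥} ×ˢ A} ∪
      {s : Set (ℝ≥0 × Ω) | ∃ i A, MeasurableSet[F i] A ∧ s = Set.Ioi i ×ˢ A}) := by
  rintro _ (⟨B, hB, rfl⟩ | ⟨i, B, hB, rfl⟩) _ (⟨B', hB', rfl⟩ | ⟨i', B', hB', rfl⟩) hne
  · refine Or.inl ⟨B ∩ B', hB.inter hB', ?_⟩
    rw [Set.prod_inter_prod, Set.inter_self]
  · obtain ⟨p, hp, hp'⟩ := hne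
    have h1 : p.1 = ⊥ := hp.1
    have h2 : i' < p.1 := hp'.1
    simp [h1] at h2
  · obtain ⟨p, hp, hp'⟩ := hne
    have h1 : p.1 = ⊥ := hp'.1
    have h2 : i < p.1 := hp.1
    simp [h1] at h2
  · refine Or.inr ⟨i ⊔ i', B ∩ B', ?_, ?_⟩
    · exact (F.mono le_sup_left _ hB).inter (F.mono le_sup_right _ hB')
    · rw [Set.prod_inter_prod, Set.Ioi_inter_Ioi]

/-- Tonelli alone gives joint measurability but not predictability. A Dynkin argument does: for a
generator over `Set.Ioi i` the integral is the truncated difference `p.1 - i` times an indicator,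
and complements are handled by subtracting from the finite length `p.1`. -/
lemma measurable_predictable_setLIntegral_indicator (F : Filtration ℝ≥0 mΩ) {D : Set (ℝ≥0 × Ω)}
    (hD : MeasurableSet[F.predictable] D) :
    Measurable[F.predictable] fun p : ℝ≥0 × Ω =>
      ∫⁻ s in Set.Ioc 0 p.1, D.indicator (fun _ => (1 : ℝ≥0∞)) (s, p.2) ∂timeMeasure := by
  let : MeasurableSpace (ℝ≥0 × Ω) := F.predictable
  have hsec : ∀ D : Set (ℝ≥0 × Ω), MeasurableSet D → ∀ ω : Ω,
      Measurable fun s => D.indicator (fun _ => (1 : ℝ≥0∞)) (s, ω) := fun D hD ω => by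
    have h1 : Measurable[(inferInstance : MeasurableSpace ℝ≥0).prod mΩ]
        (D.indicator (fun _ => (1 : ℝ≥0∞))) :=
      measurable_const.indicator (predictable_le_prod F _ hD)
    exact h1.comp measurable_prodMk_right
  refine MeasurableSpace.induction_on_inter (m := F.predictable)
    (C := fun D _ => Measurable fun p : ℝ≥0 × Ω =>
      ∫⁻ s in Set.Ioc 0 p.1, D.indicator (fun _ => (1 : ℝ≥0∞)) (s, p.2) ∂timeMeasure)
    rfl (isPiSystem_predictable F) (by simp) ?_ ?_ ?_ D hD
  · rintro _ (⟨B, hB, rfl⟩ | ⟨i, B, hB, rfl⟩)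
    · have : (fun p : ℝ≥0 × Ω => ∫⁻ s in Set.Ioc 0 p.1,
          (({⊥} : Set ℝ≥0) ×ˢ B).indicator (fun _ => (1 : ℝ≥0∞)) (s, p.2) ∂timeMeasure)
          = fun _ => 0 := by
        ext p
        rw [setLIntegral_congr_fun (g := fun _ => 0) measurableSet_Ioc, lintegral_zero]
        intro s hs
        refine Set.indicator_of_notMem (fun h => ?_) _
        have h1 : s = ⊥ := h.1
        simp [h1] at hs
      rw [this]
      exact measurable_const
    · have : (fun p : ℝ≥0 × Ω => ∫⁻ s in Set.Ioc 0 p.1,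
          (Set.Ioi i ×ˢ B).indicator (fun _ => (1 : ℝ≥0∞)) (s, p.2) ∂timeMeasure)
          = (Set.Ioi i ×ˢ B).indicator fun p => ((p.1 - i : ℝ≥0) : ℝ≥0∞) := by
        ext p
        by_cases hB : p.2 ∈ B
        · have h1 : (fun s => (Set.Ioi i ×ˢ B).indicator (fun _ => (1 : ℝ≥0∞)) (s, p.2))
              = (Set.Ioi i).indicator fun _ => (1 : ℝ≥0∞) := by
            ext s
            simp only [Set.indicator, Set.mem_prod, hB, and_true]
          rw [h1, setLIntegral_indicator measurableSet_Ioi, setLIntegral_one, Set.inter_comm,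
            Set.Ioc_inter_Ioi, timeMeasure_Ioc]
          by_cases hp : i < p.1
          · rw [Set.indicator_of_mem (show p ∈ Set.Ioi i ×ˢ B from ⟨hp, hB⟩)]
            simp
          · rw [Set.indicator_of_notMem fun h => hp h.1]
            simp [tsub_eq_zero_of_le (not_lt.1 hp)]
        · rw [Set.indicator_of_notMem fun h => hB h.2]
          simp [Set.indicator, hB]
      rw [this]
      refine Measurable.indicator ?_ (measurableSet_predictable_Ioi_prod hB)
      exact ((measurable_predictable_fst F).sub_const i).coe_nnreal_ennreal
  · intro D hD ih
    have : (fun p : ℝ≥0 × Ω => ∫⁻ s in Set.Ioc 0 p.1,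
        Dᶜ.indicator (fun _ => (1 : ℝ≥0∞)) (s, p.2) ∂timeMeasure) = fun p => (p.1 : ℝ≥0∞)
        - ∫⁻ s in Set.Ioc 0 p.1, D.indicator (fun _ => (1 : ℝ≥0∞)) (s, p.2) ∂timeMeasure := by
      ext p
      have hle : ∫⁻ s in Set.Ioc 0 p.1, D.indicator (fun _ => (1 : ℝ≥0∞)) (s, p.2) ∂timeMeasure
          ≤ p.1 := by
        refine (lintegral_mono (g := fun _ => 1) fun s => ?_).trans ?_
        · exact Set.indicator_le_self' (fun _ _ => zero_le) _
        · simp [timeMeasure_Ioc]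
      refine ENNReal.eq_sub_of_add_eq (ne_top_of_le_ne_top ENNReal.coe_ne_top hle) ?_
      rw [← lintegral_add_left (hsec _ hD.compl p.2)]
      have : ∀ s, Dᶜ.indicator (fun _ => (1 : ℝ≥0∞)) (s, p.2)
          + D.indicator (fun _ => (1 : ℝ≥0∞)) (s, p.2) = 1 := fun s => by
        by_cases h : (s, p.2) ∈ D <;> simp [h]
      simp only [this]
      simp [timeMeasure_Ioc]
    rw [this]
    exact (measurable_predictable_fst F).coe_nnreal_ennreal.sub ih
  · intro f hdisj hf ih
    have : (fun p : ℝ≥0 × Ω => ∫⁻ s in Set.Ioc 0 p.1,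
        (⋃ i, f i).indicator (fun _ => (1 : ℝ≥0∞)) (s, p.2) ∂timeMeasure) = fun p =>
        ∑' i, ∫⁻ s in Set.Ioc 0 p.1, (f i).indicator (fun _ => (1 : ℝ≥0∞)) (s, p.2)
          ∂timeMeasure := by
      ext p
      rw [← lintegral_tsum fun i => (hsec _ (hf i) p.2).aemeasurable]
      congr with s
      by_cases h : (s, p.2) ∈ ⋃ i, f i
      · obtain ⟨j, hj⟩ := Set.mem_iUnion.1 h
        rw [Set.indicator_of_mem h, tsum_eq_single j, Set.indicator_of_mem hj]
        exact fun i hij => Set.indicator_of_notMem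
          (fun hi => Set.disjoint_left.1 (hdisj hij) hi hj) _
      · rw [Set.indicator_of_notMem h, ENNReal.tsum_eq_zero.2 fun i =>
          Set.indicator_of_notMem (fun hi => h (Set.mem_iUnion.2 ⟨i, hi⟩)) _]
    rw [this]
    exact Measurable.tsum ih

/-- The time integral of a nonnegative predictable process is predictable. -/
lemma measurable_predictable_setLIntegral (F : Filtration ℝ≥0 mΩ) {g : ℝ≥0 × Ω → ℝ≥0∞}
    (hg : Measurable[F.predictable] g) :
    Measurable[F.predictable] fun p : ℝ≥0 × Ω =>
      ∫⁻ s in Set.Ioc 0 p.1, g (s, p.2) ∂timeMeasure := by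
  have hsec : ∀ g : ℝ≥0 × Ω → ℝ≥0∞, Measurable[F.predictable] g → ∀ ω : Ω,
      Measurable fun s => g (s, ω) := fun g hg ω =>
    (hg.mono (predictable_le_prod F) le_rfl).comp measurable_prodMk_right
  refine @Measurable.ennreal_induction _ F.predictable
    (fun g => Measurable[F.predictable] fun p : ℝ≥0 × Ω =>
      ∫⁻ s in Set.Ioc 0 p.1, g (s, p.2) ∂timeMeasure) ?_ ?_ ?_ g hg
  · intro c D hD
    have := (measurable_predictable_setLIntegral_indicator F hD).const_mul c
    convert this using 2 with p
    rw [← lintegral_const_mul]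
    · congr with s
      simp [Set.indicator]
    · exact hsec _ (measurable_const.indicator hD) p.2
  · intro f g _ hf hg ihf ihg
    simp only [Pi.add_apply]
    have : ∀ p : ℝ≥0 × Ω, ∫⁻ s in Set.Ioc 0 p.1, (f (s, p.2) + g (s, p.2)) ∂timeMeasure
        = (∫⁻ s in Set.Ioc 0 p.1, f (s, p.2) ∂timeMeasure)
          + ∫⁻ s in Set.Ioc 0 p.1, g (s, p.2) ∂timeMeasure := fun p =>
      lintegral_add_left (hsec f hf p.2) _
    simp only [this]
    exact ihf.add ihg
  · intro f hf hmono ih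
    have : ∀ p : ℝ≥0 × Ω, ∫⁻ s in Set.Ioc 0 p.1, (⨆ n, f n (s, p.2)) ∂timeMeasure
        = ⨆ n, ∫⁻ s in Set.Ioc 0 p.1, f n (s, p.2) ∂timeMeasure := fun p =>
      lintegral_iSup (fun n => hsec _ (hf n) p.2) fun i j hij s => hmono hij _
    simp only [this]
    exact Measurable.iSup ih

end Predictable

/-! ### Recovering arrival times and marks from the natural filtration. -/

namespace MarkedPointProcess

section Counting

variable {Ω A : Type*} [mΩ : MeasurableSpace Ω] [MeasurableSpace A]

/-- Here `m` is the number of arrivals up to `s`, finite by non-explosion. -/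
lemma exists_time_le_iff (N : MarkedPointProcess Ω A) (ω : Ω) (s : ℝ≥0) :
    ∃ m, ∀ j, N.time j ω ≤ s ↔ j < m := by
  classical
  have h : ∃ m, s < N.time m ω := ((N.tendsto_time ω).eventually_gt_atTop s).exists
  refine ⟨Nat.find h, fun j => ⟨fun hj => ?_, fun hj => not_lt.1 (Nat.find_min h hj)⟩⟩
  by_contra! hlt
  exact (Nat.find_spec h).not_ge (((N.strictMono_time ω).monotone hlt).trans hj)

/-- Only an upper bound `m` on the number of arrivals is required, so `m` can be chosen
independently of `ω`; the indicators of the times discard the excess terms. -/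
lemma randomMeasure_Ioc_prod (N : MarkedPointProcess Ω A) {ω : Ω} {s : ℝ≥0} {m : ℕ}
    (hm : ∀ j, N.time j ω ≤ s → j < m) {C : Set A} (hC : MeasurableSet C) :
    N.randomMeasure ω (Set.Ioc 0 s ×ˢ C) = ∑ j ∈ Finset.range m,
      (Set.Iic s).indicator 1 (N.time j ω) * C.indicator 1 (N.mark j ω) := by
  rw [randomMeasure, Measure.sum_apply _ (measurableSet_Ioc.prod hC)]
  have h : ∀ j, Measure.dirac (N.time j ω, N.mark j ω) (Set.Ioc 0 s ×ˢ C)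
      = (Set.Iic s).indicator 1 (N.time j ω) * C.indicator 1 (N.mark j ω) := fun j => by
    rw [Measure.dirac_apply' _ (measurableSet_Ioc.prod hC)]
    by_cases h1 : N.time j ω ≤ s <;> by_cases h2 : N.mark j ω ∈ C <;>
      simp [h1, h2, N.time_pos j ω]
  simp only [h]
  refine tsum_eq_sum fun j hj => ?_
  rw [Set.indicator_of_notMem, zero_mul]
  exact fun h => hj (Finset.mem_range.2 (hm j h))

lemma randomMeasure_Ioc_prod_of_iff (N : MarkedPointProcess Ω A) {ω : Ω} {s : ℝ≥0} {m : ℕ}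
    (hm : ∀ j, N.time j ω ≤ s ↔ j < m) {C : Set A} (hC : MeasurableSet C) :
    N.randomMeasure ω (Set.Ioc 0 s ×ˢ C)
      = ∑ j ∈ Finset.range m, C.indicator 1 (N.mark j ω) := by
  rw [N.randomMeasure_Ioc_prod (fun j => (hm j).1) hC]
  refine Finset.sum_congr rfl fun j hj => ?_
  rw [Set.indicator_of_mem (show N.time j ω ∈ Set.Iic s from (hm j).2 (Finset.mem_range.1 hj)),
    Pi.one_apply, one_mul]

lemma randomMeasure_Ioc_prod_univ (N : MarkedPointProcess Ω A) {ω : Ω} {s : ℝ≥0} {m : ℕ}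
    (hm : ∀ j, N.time j ω ≤ s ↔ j < m) :
    N.randomMeasure ω (Set.Ioc 0 s ×ˢ Set.univ) = m := by
  simp [N.randomMeasure_Ioc_prod_of_iff hm MeasurableSet.univ]

lemma randomMeasure_Ioc_prod_univ_eq_iff (N : MarkedPointProcess Ω A) {ω : Ω} {s : ℝ≥0} {n : ℕ} :
    N.randomMeasure ω (Set.Ioc 0 s ×ˢ Set.univ) = n ↔ ∀ j, N.time j ω ≤ s ↔ j < n := by
  refine ⟨fun h => ?_, fun h => N.randomMeasure_Ioc_prod_univ h⟩
  obtain ⟨m, hm⟩ := N.exists_time_le_iff ω s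
  rw [N.randomMeasure_Ioc_prod_univ hm] at h
  rwa [← Nat.cast_injective h]

lemma measurable_naturalFiltration (N : MarkedPointProcess Ω A) {s t : ℝ≥0} (hst : s ≤ t)
    {C : Set A} (hC : MeasurableSet C) :
    Measurable[N.naturalFiltration t] fun ω => N.randomMeasure ω (Set.Ioc 0 s ×ˢ C) := by
  rw [measurable_iff_comap_le]
  exact le_iSup₂_of_le (f := fun (s : ℝ≥0) (_ : s ≤ t) => ⨆ (C : Set A) (_ : MeasurableSet C),
    MeasurableSpace.comap (fun ω => N.randomMeasure ω (Set.Ioc 0 s ×ˢ C)) inferInstance) s hst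
    (le_iSup₂_of_le (f := fun (C : Set A) (_ : MeasurableSet C) => MeasurableSpace.comap
      (fun ω => N.randomMeasure ω (Set.Ioc 0 s ×ˢ C)) inferInstance) C hC le_rfl)

lemma measurableSet_time_le (N : MarkedPointProcess Ω A) (n : ℕ) (t : ℝ≥0) :
    MeasurableSet[N.naturalFiltration t] {ω | N.time n ω ≤ t} := by
  have : {ω | N.time n ω ≤ t}
      = (fun ω => N.randomMeasure ω (Set.Ioc 0 t ×ˢ Set.univ)) ⁻¹' Set.Ici ((n + 1 : ℕ) : ℝ≥0∞) := by
    ext ω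
    obtain ⟨m, hm⟩ := N.exists_time_le_iff ω t
    simp only [Set.mem_ofPred_eq, Set.mem_preimage, N.randomMeasure_Ioc_prod_univ hm, hm,
      Set.mem_Ici, Nat.cast_le, Nat.succ_le_iff]
  rw [this]
  exact N.measurable_naturalFiltration le_rfl MeasurableSet.univ measurableSet_Ici

/-- A mark is visible as an increment: between a time with exactly `n` arrivals and a later one with
exactly `n + 1`, the count in `C` grows by one if and only if the new mark lies in `C`. A countable
set of such times suffices. -/
lemma measurableSet_mark_mem_time_le (N : MarkedPointProcess Ω A) (n : ℕ) (t : ℝ≥0) {C : Set A}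
    (hC : MeasurableSet C) :
    MeasurableSet[N.naturalFiltration t] (N.mark n ⁻¹' C ∩ {ω | N.time n ω ≤ t}) := by
  let d := TopologicalSpace.denseSeq ℝ≥0
  have hd : Dense (Set.range d) := TopologicalSpace.denseRange_denseSeq ℝ≥0
  -- The later time must not exceed `t`, so `t` itself is added to the dense sequence to cover an
  -- arrival exactly at `t`.
  let q : Option ℕ → ℝ≥0 := fun o => o.elim t d
  let M : ℝ≥0 → Set A → Ω → ℝ≥0∞ := fun s C ω => N.randomMeasure ω (Set.Ioc 0 s ×ˢ C)
  have hM : ∀ s ≤ t, ∀ C, MeasurableSet C → Measurable[N.naturalFiltration t] (M s C) :=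
    fun s hs C hC => N.measurable_naturalFiltration hs hC
  have key : N.mark n ⁻¹' C ∩ {ω | N.time n ω ≤ t}
      = ⋃ (i : ℕ) (o : Option ℕ) (_ : d i ≤ t) (_ : q o ≤ t),
        {ω | M (d i) Set.univ ω = n} ∩ {ω | M (q o) Set.univ ω = (n + 1 : ℕ)} ∩
          {ω | M (q o) C ω = M (d i) C ω + 1} := by
    ext ω
    simp only [Set.mem_inter_iff, Set.mem_preimage, Set.mem_ofPred_eq, Set.mem_iUnion,
      exists_prop, M, randomMeasure_Ioc_prod_univ_eq_iff]
    have hmono := N.strictMono_time ω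
    constructor
    · rintro ⟨hC', ht⟩
      obtain ⟨i, hi, hi'⟩ : ∃ i, (∀ j < n, N.time j ω ≤ d i) ∧ d i < N.time n ω := by
        rcases n with _ | n
        · obtain ⟨_, ⟨i, rfl⟩, hi⟩ := hd.exists_between (N.time_pos 0 ω)
          exact ⟨i, by simp, hi.2⟩
        · obtain ⟨_, ⟨i, rfl⟩, hi⟩ := hd.exists_between (hmono n.lt_succ_self)
          exact ⟨i, fun j hj => (hmono.monotone (Nat.lt_succ_iff.1 hj)).trans hi.1.le, hi.2⟩
      obtain ⟨o, ho, ho', ho''⟩ : ∃ o, q o ≤ t ∧ N.time n ω ≤ q o ∧ q o < N.time (n + 1) ω := by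
        rcases ht.eq_or_lt with h | h
        · exact ⟨none, le_rfl, ht, h.symm.trans_lt (hmono n.lt_succ_self)⟩
        · obtain ⟨_, ⟨k, rfl⟩, hk⟩ := hd.exists_between (lt_min h (hmono n.lt_succ_self))
          exact ⟨some k, hk.2.le.trans (min_le_left _ _), hk.1.le, hk.2.trans_le (min_le_right _ _)⟩
      have h1 : ∀ j, N.time j ω ≤ d i ↔ j < n := fun j =>
        ⟨fun h => hmono.lt_iff_lt.1 (h.trans_lt hi'), hi j⟩
      have h2 : ∀ j, N.time j ω ≤ q o ↔ j < n + 1 := fun j =>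
        ⟨fun h => hmono.lt_iff_lt.1 (h.trans_lt ho''),
          fun h => (hmono.monotone (Nat.lt_succ_iff.1 h)).trans ho'⟩
      refine ⟨i, o, hi'.le.trans ht, ho, ⟨h1, h2⟩, ?_⟩
      rw [N.randomMeasure_Ioc_prod_of_iff h1 hC, N.randomMeasure_Ioc_prod_of_iff h2 hC,
        Finset.sum_range_succ, Set.indicator_of_mem hC', Pi.one_apply]
    · rintro ⟨i, o, _, ho, ⟨h1, h2⟩, h3⟩
      refine ⟨?_, ((h2 n).2 n.lt_succ_self).trans ho⟩
      rw [N.randomMeasure_Ioc_prod_of_iff h1 hC, N.randomMeasure_Ioc_prod_of_iff h2 hC,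
        Finset.sum_range_succ] at h3
      by_contra hn
      rw [Set.indicator_of_notMem hn, add_zero] at h3
      -- Finiteness excludes `∞ + 1 = ∞`, which would make the increment condition void.
      have hfin : ∑ j ∈ Finset.range n, C.indicator (1 : A → ℝ≥0∞) (N.mark j ω) ≠ ∞ :=
        ENNReal.sum_ne_top.2 fun j _ => by
          by_cases h : N.mark j ω ∈ C <;> simp [h]
      exact (ENNReal.lt_add_right hfin one_ne_zero).ne h3
  rw [key]
  refine MeasurableSet.iUnion fun i => MeasurableSet.iUnion fun o => MeasurableSet.iUnion fun hi =>
    MeasurableSet.iUnion fun ho => ?_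
  refine ((hM _ hi _ MeasurableSet.univ (measurableSet_singleton _)).inter
    (hM _ ho _ MeasurableSet.univ (measurableSet_singleton _))).inter ?_
  exact @measurableSet_eq_fun _ _ (N.naturalFiltration t) _ _ _ _ (hM _ ho _ hC)
    ((hM _ hi _ hC).add_const 1)

/-- A marked point process is adapted to every filtration that contains its natural filtration. -/
lemma isAdaptedTo_of_le (N : MarkedPointProcess Ω A) {F : Filtration ℝ≥0 mΩ}
    (hF : N.naturalFiltration ≤ F) : N.IsAdaptedTo F := by
  intro n
  have h : IsStoppingTime F fun ω => (N.time n ω : WithTop ℝ≥0) := fun t => by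
    simp only [WithTop.coe_le_coe]
    exact hF t _ (N.measurableSet_time_le n t)
  refine ⟨h, fun C hC => ⟨?_, fun t => ?_⟩⟩
  -- Arrival times are finite, so exhausting by `time n ≤ k` places the event in the supremum of the
  -- filtration.
  · have : N.mark n ⁻¹' C = ⋃ k : ℕ, N.mark n ⁻¹' C ∩ {ω | N.time n ω ≤ k} := by
      rw [← Set.inter_iUnion, Set.iUnion_eq_univ_iff.2, Set.inter_univ]
      exact fun ω => exists_nat_ge (N.time n ω)
    rw [this]
    exact MeasurableSet.iUnion fun k => le_iSup F (k : ℝ≥0) _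
      (hF _ _ (N.measurableSet_mark_mem_time_le n k hC))
  · simp only [WithTop.coe_le_coe]
    exact hF t _ (N.measurableSet_mark_mem_time_le n t hC)

end Counting

/-! ### Predictable fields between consecutive arrivals. -/

section Trace

variable {Ω 𝒳 A : Type*} [mΩ : MeasurableSpace Ω] [m𝒳 : MeasurableSpace 𝒳] [MeasurableSpace A]

/-- Where `s < N.time n ω`, only points of index below `n` can lie in `(0, s]`, and these are
functions of `X`. -/
lemma comap_naturalFiltration_le (N : MarkedPointProcess Ω A) {X : Ω → 𝒳} {n : ℕ}
    (htime : ∀ j < n, Measurable[m𝒳.comap X] (N.time j))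
    (hmark : ∀ j < n, Measurable[m𝒳.comap X] (N.mark j)) (s : ℝ≥0) :
    (N.naturalFiltration s).comap (Subtype.val : {ω // s < N.time n ω} → Ω)
      ≤ m𝒳.comap fun ω : {ω // s < N.time n ω} => X ω := by
  simp only [naturalFiltration, MeasurableSpace.comap_iSup]
  refine iSup₂_le fun u hu => iSup₂_le fun C hC => ?_
  rw [MeasurableSpace.comap_comp, ← measurable_iff_comap_le]
  have hval : Measurable[m𝒳.comap fun ω : {ω // s < N.time n ω} => X ω, m𝒳.comap X]
      (Subtype.val : {ω // s < N.time n ω} → Ω) := by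
    rw [measurable_iff_comap_le, MeasurableSpace.comap_comp]
    rfl
  have heq : ((fun ω => N.randomMeasure ω (Set.Ioc 0 u ×ˢ C)) ∘
        (Subtype.val : {ω // s < N.time n ω} → Ω))
      = fun ω : {ω // s < N.time n ω} => ∑ j ∈ Finset.range n, (Set.Iic u).indicator 1 (N.time j ω) *
        C.indicator 1 (N.mark j ω) := by
    ext ω
    exact N.randomMeasure_Ioc_prod (fun j hj =>
      (N.strictMono_time ω).lt_iff_lt.1 (hj.trans_lt (hu.trans_lt ω.2))) hC
  rw [heq]
  refine Finset.measurable_sum _ fun j hj => Measurable.mul ?_ ?_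
  · exact ((measurable_one.indicator measurableSet_Iic).comp
      (htime j (Finset.mem_range.1 hj))).comp hval
  · exact ((measurable_one.indicator hC).comp (hmark j (Finset.mem_range.1 hj))).comp hval

end Trace

end MarkedPointProcess

section Trace

variable {Ω 𝒳 A : Type*} [mΩ : MeasurableSpace Ω] [m𝒳 : MeasurableSpace 𝒳] [MeasurableSpace A]

/-- If, for all `s`, the traces of `F s` on `{s < τ}` are generated by `X`, then predictable fields
depend up to time `τ` only on the time, on `X` and on the mark. -/
lemma exists_measurable_eq_of_predictable {F : Filtration ℝ≥0 mΩ} {τ : Ω → ℝ≥0}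
    (hτ : ∀ ω, 0 < τ ω) {X : Ω → 𝒳}
    (hF : ∀ s, (F s).comap (Subtype.val : {ω // s < τ ω} → Ω)
      ≤ m𝒳.comap fun ω : {ω // s < τ ω} => X ω)
    {H : (ℝ≥0 × Ω) × A → ℝ≥0∞} (hH : Measurable[F.predictable.prod inferInstance] H) :
    ∃ K : (ℝ≥0 × 𝒳) × A → ℝ≥0∞, Measurable K ∧
      ∀ t ω a, t ≤ τ ω → H ((t, ω), a) = K ((t, X ω), a) := by
  let D := {p : ℝ≥0 × Ω // p.1 ≤ τ p.2}
  let f : D × A → (ℝ≥0 × 𝒳) × A := fun q => ((q.1.1.1, X q.1.1.2), q.2)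
  -- With the σ-algebra on `D` pulled back from `(t, X)`, the claim becomes an inclusion that can be
  -- checked on the predictable generators.
  let mD : MeasurableSpace D := MeasurableSpace.comap (fun p : D => (p.1.1, X p.1.2)) inferInstance
  have hle : F.predictable.comap (Subtype.val : D → ℝ≥0 × Ω) ≤ mD := by
    have h1 : ∀ s B, MeasurableSet[F s] B → ∃ B', MeasurableSet B' ∧
        ∀ ω, s < τ ω → (X ω ∈ B' ↔ ω ∈ B) := by
      intro s B hB
      obtain ⟨B', hB', h⟩ := hF s _ ⟨B, hB, rfl⟩
      exact ⟨B', hB', fun ω hω => by simpa using Set.ext_iff.1 h ⟨ω, hω⟩⟩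
    rw [MeasurableSpace.comap_le_iff_le_map]
    refine measurableSpace_le_predictable_of_measurableSet (fun B hB => ?_) fun s B hB => ?_
    -- At time zero positivity of `τ` makes the trace hypothesis available everywhere.
    · obtain ⟨B', hB', h⟩ := h1 _ B hB
      refine ⟨{⊥} ×ˢ B', (measurableSet_singleton _).prod hB', ?_⟩
      ext p
      simp [h p.1.2 (hτ _)]
    -- From `s < t ≤ τ` follows `s < τ`: left-open generators are what makes the description valid
    -- at `t = τ` too.
    · obtain ⟨B', hB', h⟩ := h1 _ B hB
      refine ⟨Set.Ioi s ×ˢ B', measurableSet_Ioi.prod hB', ?_⟩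
      ext p
      simp only [Set.mem_preimage, Set.mem_prod, Set.mem_Ioi]
      exact and_congr_right fun hs => h p.1.2 (hs.trans_le p.2)
  let g : D × A → ℝ≥0∞ := fun q => H (q.1.1, q.2)
  have hg : Measurable[MeasurableSpace.comap f inferInstance] g := by
    let : MeasurableSpace (D × A) := MeasurableSpace.comap f inferInstance
    have hf : Measurable f := comap_measurable f
    refine Measurable.comp hH ?_
    refine @Measurable.prodMk _ _ _ _ F.predictable _ _ _ ?_ hf.snd
    have h2 : Measurable fun q : D × A => q.1 := by
      rw [measurable_iff_comap_le]
      rw [show mD = MeasurableSpace.comap (fun p : D => (p.1.1, X p.1.2)) inferInstance from rfl,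
        MeasurableSpace.comap_comp, ← measurable_iff_comap_le]
      exact hf.fst
    have h3 : Measurable[mD, F.predictable] (Subtype.val : D → ℝ≥0 × Ω) :=
      measurable_iff_comap_le.2 hle
    exact h3.comp h2
  obtain ⟨K, hK, hgK⟩ := hg.exists_eq_measurable_comp
  exact ⟨K, hK, fun t ω a h => congr_fun hgK (⟨(t, ω), h⟩, a)⟩

end Trace

/-! ### Integrals with moving endpoints and integrals of independent pairs. -/

section Integrals

lemma measurable_setLIntegral_Ioc {X : Type*} [MeasurableSpace X] {a b : X → ℝ≥0}
    (ha : Measurable a) (hb : Measurable b) {ψ : X × ℝ≥0 → ℝ≥0∞} (hψ : Measurable ψ) :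
    Measurable fun x => ∫⁻ t in Set.Ioc (a x) (b x), ψ (x, t) ∂timeMeasure := by
  let S : Set (X × ℝ≥0) := {q | a q.1 < q.2} ∩ {q | q.2 ≤ b q.1}
  have hS : MeasurableSet S := (measurableSet_lt (ha.comp measurable_fst) measurable_snd).inter
    (measurableSet_le measurable_snd (hb.comp measurable_fst))
  have : ∀ x, ∫⁻ t in Set.Ioc (a x) (b x), ψ (x, t) ∂timeMeasure
      = ∫⁻ t, S.indicator ψ (x, t) ∂timeMeasure := fun x => by
    rw [← lintegral_indicator measurableSet_Ioc]
    rfl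
  simp only [this]
  exact (hψ.indicator hS).lintegral_prod_right'

lemma setLIntegral_timeMeasure_Ioc_zero_add (a e : ℝ≥0) (ψ : ℝ≥0 → ℝ≥0∞) :
    ∫⁻ t in Set.Ioc 0 e, ψ (a + t) ∂timeMeasure = ∫⁻ t in Set.Ioc a (a + e), ψ t ∂timeMeasure := by
  have := setLIntegral_timeMeasure_Ioc_add 0 e (ψ := fun t => ψ (a + t))
  simp only [zero_add] at this
  rw [this, setLIntegral_timeMeasure_Ioc_add]

lemma lintegral_indepFun_prodMk {Ω 𝒳 𝒴 : Type*} [MeasurableSpace Ω] [MeasurableSpace 𝒳]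
    [MeasurableSpace 𝒴] {P : Measure Ω} [IsProbabilityMeasure P] {X : Ω → 𝒳} {Y : Ω → 𝒴}
    (h : IndepFun X Y P) (hX : Measurable X) (hY : Measurable Y) {Φ : 𝒳 × 𝒴 → ℝ≥0∞}
    (hΦ : Measurable Φ) :
    ∫⁻ ω, Φ (X ω, Y ω) ∂P = ∫⁻ ω₁, ∫⁻ ω₂, Φ (X ω₁, Y ω₂) ∂P ∂P := by
  have := Measure.isProbabilityMeasure_map (μ := P) hX.aemeasurable
  have := Measure.isProbabilityMeasure_map (μ := P) hY.aemeasurable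
  rw [← lintegral_map hΦ (hX.prodMk hY),
    (indepFun_iff_map_prod_eq_prod_map_map hX.aemeasurable hY.aemeasurable).1 h,
    lintegral_prod _ hΦ.aemeasurable, lintegral_map hΦ.lintegral_prod_right' hX]
  congr with ω
  exact lintegral_map (hΦ.comp measurable_prodMk_left) hY

end Integrals

/-- The marked point process on `Ω × Ω'` with waiting times `g n` and marks obtained by applying
`f` to the current value of the process `β` on `Ω` and to the random variable `U n` on `Ω'`. -/
@[simps]
def renewalMarked {Ω Ω' A : Type*} [MeasurableSpace Ω] [MeasurableSpace Ω'] [MeasurableSpace A]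
    {g : ℕ → Ω' → ℝ≥0} (hg : ∀ n, Measurable (g n)) (hpos : ∀ n ω, 0 < g n ω)
    (hlim : ∀ ω, Tendsto (fun n => ∑ j ∈ Finset.range n, g j ω) atTop atTop)
    {U : ℕ → Ω' → ℝ} (hU : ∀ n, Measurable (U n)) {β : ℝ≥0 × Ω → A} (hβ : Measurable β)
    {f : A × ℝ → A} (hf : Measurable f) : MarkedPointProcess (Ω × Ω') A where
  time n ω := ∑ j ∈ Finset.range (n + 1), g j ω.2
  mark n ω := f (β (∑ j ∈ Finset.range (n + 1), g j ω.2, ω.1), U n ω.2)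
  measurable_time n := by fun_prop
  measurable_mark n := by fun_prop
  time_pos n ω := Finset.sum_pos (fun j _ => hpos j _) (by simp)
  strictMono_time ω := strictMono_nat_of_lt_succ fun n => by
    rw [Finset.sum_range_succ _ (n + 1)]
    exact lt_add_of_pos_right _ (hpos _ _)
  tendsto_time ω := (hlim ω.2).comp (tendsto_add_atTop_nat 1)

/-! ### The compensator of a renewal process with randomized marks. -/

section Compensator

variable {Ω Ω' A : Type*} {mΩ : MeasurableSpace Ω} [MeasurableSpace Ω'] [MeasurableSpace A]
  {g : ℕ → Ω' → ℝ≥0} {U : ℕ → Ω' → ℝ} {β : ℝ≥0 × Ω → A} {f : A × ℝ → A}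

/-- The waiting times and the uniform variables that determine the first `n` points. -/
def renewalPast (g : ℕ → Ω' → ℝ≥0) (U : ℕ → Ω' → ℝ) (n : ℕ) (ω' : Ω') :
    Finset.range n → ℝ≥0 × ℝ := fun j => (g j ω', U j ω')

lemma measurable_renewalPast (hg : ∀ n, Measurable (g n)) (hU : ∀ n, Measurable (U n)) (n : ℕ) :
    Measurable (renewalPast g U n) :=
  measurable_pi_lambda _ fun j => (hg j).prodMk (hU j)

/-- The whole point of `Ω` is retained in the past variable, so `G` enters only through `G s ≤ mΩ`.
The earlier marks, which evaluate `β` at earlier arrivals, are then functions of that variable. -/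
lemma exists_eq_of_predictable_renewalMarked (hg : ∀ n, Measurable (g n))
    (hpos : ∀ n ω, 0 < g n ω)
    (hlim : ∀ ω, Tendsto (fun n => ∑ j ∈ Finset.range n, g j ω) atTop atTop)
    (hU : ∀ n, Measurable (U n)) (hβ : Measurable β) (hf : Measurable f) (G : Filtration ℝ≥0 mΩ)
    {H : (ℝ≥0 × (Ω × Ω')) × A → ℝ≥0∞}
    (hH : Measurable[(extendFiltration Ω' G ⊔ (renewalMarked hg hpos hlim hU hβ
      hf).naturalFiltration).predictable.prod inferInstance] H) (n : ℕ) :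
    ∃ K : (ℝ≥0 × (Ω × (Finset.range n → ℝ≥0 × ℝ))) × A → ℝ≥0∞, Measurable K ∧
      ∀ t ω a, t ≤ ∑ j ∈ Finset.range (n + 1), g j ω.2 →
        H ((t, ω), a) = K ((t, (ω.1, renewalPast g U n ω.2)), a) := by
  set N := renewalMarked hg hpos hlim hU hβ hf with hN
  let X : Ω × Ω' → Ω × (Finset.range n → ℝ≥0 × ℝ) := fun ω => (ω.1, renewalPast g U n ω.2)
  let m𝒳 : MeasurableSpace (Ω × (Finset.range n → ℝ≥0 × ℝ)) := inferInstance
  have hX : Measurable[m𝒳.comap X] X := comap_measurable X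
  have hXg : ∀ j < n, Measurable[m𝒳.comap X] fun ω : Ω × Ω' => g j ω.2 := fun j hj =>
    (show Measurable fun x : Ω × (Finset.range n → ℝ≥0 × ℝ) =>
      (x.2 ⟨j, Finset.mem_range.2 hj⟩).1 by fun_prop).comp hX
  have hXU : ∀ j < n, Measurable[m𝒳.comap X] fun ω : Ω × Ω' => U j ω.2 := fun j hj =>
    (show Measurable fun x : Ω × (Finset.range n → ℝ≥0 × ℝ) =>
      (x.2 ⟨j, Finset.mem_range.2 hj⟩).2 by fun_prop).comp hX
  have htime : ∀ j < n, Measurable[m𝒳.comap X] (N.time j) := fun j hj =>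
    Finset.measurable_sum _ fun i hi => hXg i ((Finset.mem_range_succ_iff.1 hi).trans_lt hj)
  have hmark : ∀ j < n, Measurable[m𝒳.comap X] (N.mark j) := fun j hj =>
    hf.comp ((hβ.comp ((htime j hj).prodMk hX.fst)).prodMk (hXU j hj))
  refine exists_measurable_eq_of_predictable (τ := N.time n) (N.time_pos n) (X := X) (fun s => ?_) hH
  rw [show (extendFiltration Ω' G ⊔ N.naturalFiltration) s
    = extendFiltration Ω' G s ⊔ N.naturalFiltration s from rfl, MeasurableSpace.comap_sup]
  refine sup_le ?_ (N.comap_naturalFiltration_le htime hmark s)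
  rw [show extendFiltration Ω' G s = (G s).comap Prod.fst from rfl, MeasurableSpace.comap_comp]
  refine (MeasurableSpace.comap_mono (G.le s)).trans ?_
  rw [← measurable_iff_comap_le]
  have := @comap_measurable {ω // s < N.time n ω} _ m𝒳 fun ω => X ω
  exact this.fst

/-- The mean over one point of a predictable field, written as a function `K` of the past. -/
lemma lintegral_renewal_step {lam : Measure A} [SFinite lam] {P' : Measure Ω'}
    [IsProbabilityMeasure P'] (hg : ∀ n, Measurable (g n)) (hU : ∀ n, Measurable (U n))
    (hf : Measurable f) {p : A × A → ℝ≥0∞} (hp : Measurable p) {r : ℝ≥0∞}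
    {b : ℝ≥0 → A} (hb : Measurable b) {n : ℕ}
    (hpast : IndepFun (renewalPast g U n) (fun ω => (g n ω, U n ω)) P')
    (hgU : IndepFun (g n) (U n) P')
    (hlawg : ∀ φ : ℝ≥0 → ℝ≥0∞, Measurable φ → ∫⁻ ω, φ (g n ω) ∂P'
      = ∫⁻ ω, ∫⁻ t in Set.Ioc 0 (g n ω), r * φ t ∂timeMeasure ∂P')
    (hlawU : ∀ (b : A) (φ : A → ℝ≥0∞), Measurable φ →
      ∫⁻ ω, φ (f (b, U n ω)) ∂P' = ∫⁻ a, φ a * p (b, a) ∂lam)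
    {K : (ℝ≥0 × (Finset.range n → ℝ≥0 × ℝ)) × A → ℝ≥0∞} (hK : Measurable K) :
    ∫⁻ ω, K ((∑ j ∈ Finset.range (n + 1), g j ω, renewalPast g U n ω),
        f (b (∑ j ∈ Finset.range (n + 1), g j ω), U n ω)) ∂P'
      = ∫⁻ ω, ∫⁻ t in Set.Ioc (∑ j ∈ Finset.range n, g j ω) (∑ j ∈ Finset.range (n + 1), g j ω),
          ∫⁻ a, K ((t, renewalPast g U n ω), a) * (r * p (b t, a)) ∂lam ∂timeMeasure ∂P' := by
  let R : (Finset.range n → ℝ≥0 × ℝ) → ℝ≥0 := fun x => ∑ j, (x j).1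
  have hR : Measurable R := by fun_prop
  have hRg : ∀ ω, ∑ j ∈ Finset.range n, g j ω = R (renewalPast g U n ω) := fun ω =>
    (Finset.sum_coe_sort (Finset.range n) fun j => g j ω).symm
  let ψ : (Finset.range n → ℝ≥0 × ℝ) × ℝ≥0 → ℝ≥0∞ := fun q =>
    ∫⁻ a, K ((q.2, q.1), a) * p (b q.2, a) ∂lam
  have hψ : Measurable ψ := Measurable.lintegral_prod_right'
    (f := fun q : ((Finset.range n → ℝ≥0 × ℝ) × ℝ≥0) × A =>
      K ((q.1.2, q.1.1), q.2) * p (b q.1.2, q.2)) (by fun_prop)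
  have hpastm := measurable_renewalPast hg hU n
  have hpair : Measurable fun ω => (g n ω, U n ω) := (hg n).prodMk (hU n)
  have hψ' : ∀ x t, ∫⁻ a, K ((t, x), a) * (r * p (b t, a)) ∂lam = r * ψ (x, t) := fun x t => by
    rw [← lintegral_const_mul _ (by fun_prop)]
    exact lintegral_congr fun a => by ring
  simp only [Finset.sum_range_succ, hRg, hψ']
  -- The past is frozen first; then the gap is separated from the uniform variable.
  rw [lintegral_indepFun_prodMk hpast hpastm hpair
    (Φ := fun q => K ((R q.1 + q.2.1, q.1), f (b (R q.1 + q.2.1), q.2.2))) (by fun_prop)]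
  have hmeas : Measurable fun q : (Finset.range n → ℝ≥0 × ℝ) × (ℝ≥0 × ℝ) =>
      ∫⁻ t in Set.Ioc (R q.1) (R q.1 + q.2.1), r * ψ (q.1, t) ∂timeMeasure :=
    measurable_setLIntegral_Ioc (a := fun q : (Finset.range n → ℝ≥0 × ℝ) × (ℝ≥0 × ℝ) => R q.1)
      (b := fun q => R q.1 + q.2.1) (ψ := fun q => r * ψ (q.1.1, q.2))
      (by fun_prop) (by fun_prop) (by fun_prop)
  rw [lintegral_indepFun_prodMk hpast hpastm hpair hmeas]
  refine lintegral_congr fun ω₁ => ?_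
  simp only
  rw [lintegral_indepFun_prodMk hgU (hg n) (hU n)
    (Φ := fun q => K ((R (renewalPast g U n ω₁) + q.1, renewalPast g U n ω₁),
      f (b (R (renewalPast g U n ω₁) + q.1), q.2))) (by fun_prop)]
  -- Integrating out the uniform variable turns the mark into an integral against `p`. The constant
  -- hazard identity `hlawg` then turns evaluation at the gap into a time integral over the gap.
  have h1 : ∀ e, ∫⁻ ω₂, K ((R (renewalPast g U n ω₁) + e, renewalPast g U n ω₁),
      f (b (R (renewalPast g U n ω₁) + e), U n ω₂)) ∂P'
      = ψ (renewalPast g U n ω₁, R (renewalPast g U n ω₁) + e) := fun e =>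
    hlawU _ (fun a => K ((R (renewalPast g U n ω₁) + e, renewalPast g U n ω₁), a)) (by fun_prop)
  simp only [h1]
  rw [hlawg (fun e => ψ (renewalPast g U n ω₁, R (renewalPast g U n ω₁) + e)) (by fun_prop)]
  refine lintegral_congr fun ω₂ => ?_
  exact setLIntegral_timeMeasure_Ioc_zero_add _ _
    fun t => r * ψ (renewalPast g U n ω₁, t)

/-- The left-open intervals miss only time zero, which is a null set. -/
lemma lintegral_timeMeasure_eq_tsum {s : ℕ → ℝ≥0} (hs0 : s 0 = 0) (hs : Monotone s)
    (hlim : Tendsto s atTop atTop) (ψ : ℝ≥0 → ℝ≥0∞) :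
    ∫⁻ t, ψ t ∂timeMeasure = ∑' n, ∫⁻ t in Set.Ioc (s n) (s (n + 1)), ψ t ∂timeMeasure := by
  have h1 : ⋃ n, Set.Ioc (s n) (s (n + 1)) = Set.Ioi 0 := by
    rw [← hs0]
    exact iUnion_Ioc_map_succ_eq_Ioi (f := s) (fun i => by simp [hs0]) (not_bddAbove_of_tendsto_atTop hlim)
  have h2 : Pairwise (Function.onFun Disjoint fun n => Set.Ioc (s n) (s (n + 1))) :=
    hs.pairwise_disjoint_on_Ioc_succ
  rw [← lintegral_iUnion (fun _ => measurableSet_Ioc) h2, h1,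
    ← setLIntegral_univ, ← Set.Ici_bot]
  exact (setLIntegral_congr Ioi_ae_eq_Ici).symm

/-- The compensator of `renewalMarked`. -/
theorem isCompensator_renewalMarked {lam : Measure A} [SFinite lam] {P : Measure Ω}
    [IsProbabilityMeasure P] {P' : Measure Ω'} [IsProbabilityMeasure P']
    (hg : ∀ n, Measurable (g n)) (hpos : ∀ n ω, 0 < g n ω)
    (hlim : ∀ ω, Tendsto (fun n => ∑ j ∈ Finset.range n, g j ω) atTop atTop)
    (hU : ∀ n, Measurable (U n)) (hβ : Measurable β) (hf : Measurable f)
    (G : Filtration ℝ≥0 mΩ) {p : A × A → ℝ≥0} (hp : Measurable p) {r : ℝ≥0}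
    (hpast : ∀ n, IndepFun (renewalPast g U n) (fun ω => (g n ω, U n ω)) P')
    (hgU : ∀ n, IndepFun (g n) (U n) P')
    (hlawg : ∀ n, ∀ φ : ℝ≥0 → ℝ≥0∞, Measurable φ → ∫⁻ ω, φ (g n ω) ∂P'
      = ∫⁻ ω, ∫⁻ t in Set.Ioc 0 (g n ω), r * φ t ∂timeMeasure ∂P')
    (hlawU : ∀ n, ∀ (b : A) (φ : A → ℝ≥0∞), Measurable φ →
      ∫⁻ ω, φ (f (b, U n ω)) ∂P' = ∫⁻ a, φ a * p (b, a) ∂lam)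
    (hν : Measurable[(extendFiltration Ω' G ⊔ (renewalMarked hg hpos hlim hU hβ
      hf).naturalFiltration).predictable.prod inferInstance]
      fun q : (ℝ≥0 × (Ω × Ω')) × A => r * p (β (q.1.1, q.1.2.1), q.2)) :
    (renewalMarked hg hpos hlim hU hβ hf).IsCompensator
      (extendFiltration Ω' G ⊔ (renewalMarked hg hpos hlim hU hβ hf).naturalFiltration)
      (P.prod P') (fun ω => (timeMeasure.prod lam).withDensity fun x =>
        ((r * p (β (x.1, ω.1), x.2) : ℝ≥0) : ℝ≥0∞)) := by
  set N := renewalMarked hg hpos hlim hU hβ hf with hN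
  set F := extendFiltration Ω' G ⊔ N.naturalFiltration with hF
  have hν' : Measurable fun q : (ℝ≥0 × A) × (Ω × Ω') => r * p (β (q.1.1, q.2.1), q.1.2) := by
    fun_prop
  refine ⟨fun B hB => ?_, fun C hC => ?_, fun H hH => ?_⟩
  · simp only [withDensity_apply _ hB]
    exact Measurable.lintegral_prod_left' (f := fun q : (ℝ≥0 × A) × (Ω × Ω') =>
      ((r * p (β (q.1.1, q.2.1), q.1.2) : ℝ≥0) : ℝ≥0∞)) hν'.coe_nnreal_ennreal
  · have h1 : ∀ q : ℝ≥0 × (Ω × Ω'), (timeMeasure.prod lam).withDensity (fun x =>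
        ((r * p (β (x.1, q.2.1), x.2) : ℝ≥0) : ℝ≥0∞)) (Set.Ioc 0 q.1 ×ˢ C)
        = ∫⁻ s in Set.Ioc 0 q.1, ∫⁻ a in C, ((r * p (β (s, q.2.1), a) : ℝ≥0) : ℝ≥0∞) ∂lam
          ∂timeMeasure := fun q => by
      rw [withDensity_apply _ (measurableSet_Ioc.prod hC), ← Measure.prod_restrict,
        lintegral_prod _ (by fun_prop)]
    simp only [h1]
    refine measurable_predictable_setLIntegral F
      (g := fun q => ∫⁻ a in C, ((r * p (β (q.1, q.2.1), a) : ℝ≥0) : ℝ≥0∞) ∂lam) ?_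
    exact @Measurable.lintegral_prod_right' _ _ F.predictable _ _ _ _ hν.coe_nnreal_ennreal
  · have hH' : Measurable H := hH.mono
      (sup_le_sup (MeasurableSpace.comap_mono (predictable_le_prod F)) le_rfl) le_rfl
    -- One representation per gap: `K n` describes `H` up to and including the arrival of index `n`,
    -- where the random measure evaluates it.
    choose K hK hHK using exists_eq_of_predictable_renewalMarked hg hpos hlim hU hβ hf G hH
    have hsec : ∀ ω, Measurable fun x : ℝ≥0 × A => H ((x.1, ω), x.2) := fun ω => by fun_prop
    have hpastm := measurable_renewalPast hg hU
    let I : ℕ → Ω × Ω' → ℝ≥0∞ := fun n ω =>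
      ∫⁻ t in Set.Ioc (∑ j ∈ Finset.range n, g j ω.2) (∑ j ∈ Finset.range (n + 1), g j ω.2),
        ∫⁻ a, H ((t, ω), a) * ((r : ℝ≥0∞) * p (β (t, ω.1), a)) ∂lam ∂timeMeasure
    have hI : ∀ n, Measurable (I n) := fun n => by
      refine measurable_setLIntegral_Ioc
        (a := fun ω : Ω × Ω' => ∑ j ∈ Finset.range n, g j ω.2)
        (b := fun ω : Ω × Ω' => ∑ j ∈ Finset.range (n + 1), g j ω.2)
        (ψ := fun q => ∫⁻ a, H ((q.2, q.1), a) * ((r : ℝ≥0∞) * p (β (q.2, q.1.1), a)) ∂lam)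
        (by fun_prop) (by fun_prop) ?_
      exact Measurable.lintegral_prod_right' (f := fun q : ((Ω × Ω') × ℝ≥0) × A =>
        H ((q.1.2, q.1.1), q.2) * ((r : ℝ≥0∞) * p (β (q.1.2, q.1.1.1), q.2))) (by fun_prop)
    have hleft : ∀ ω, ∫⁻ x, H ((x.1, ω), x.2) ∂N.randomMeasure ω
        = ∑' n, H ((N.time n ω, ω), N.mark n ω) := fun ω => by
      rw [MarkedPointProcess.randomMeasure, lintegral_sum_measure]
      exact tsum_congr fun n => lintegral_dirac' _ (hsec ω)
    have hright : ∀ ω, ∫⁻ x, H ((x.1, ω), x.2) ∂((timeMeasure.prod lam).withDensity fun x =>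
        ((r * p (β (x.1, ω.1), x.2) : ℝ≥0) : ℝ≥0∞)) = ∑' n, I n ω := fun ω => by
      rw [lintegral_withDensity_eq_lintegral_mul _ (by fun_prop) (hsec ω),
        lintegral_prod _ (by fun_prop), lintegral_timeMeasure_eq_tsum
          (s := fun n => ∑ j ∈ Finset.range n, g j ω.2) (by simp)
          (monotone_nat_of_le_succ fun n => by rw [Finset.sum_range_succ]; exact le_self_add)
          (hlim ω.2)]
      refine tsum_congr fun n => lintegral_congr fun t => lintegral_congr fun a => ?_
      simp only [Pi.mul_apply, ENNReal.coe_mul]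
      ring
    simp only [hleft, hright]
    have hterm : ∀ n, Measurable fun ω => H ((N.time n ω, ω), N.mark n ω) := fun n => by
      have := N.measurable_time n
      have := N.measurable_mark n
      fun_prop
    rw [lintegral_tsum fun n => (hterm n).aemeasurable, lintegral_tsum fun n => (hI n).aemeasurable]
    refine tsum_congr fun n => ?_
    rw [lintegral_prod _ (hterm n).aemeasurable, lintegral_prod _ (hI n).aemeasurable]
    -- With the point of `Ω` frozen, `β` becomes a deterministic path and only the independence on
    -- `Ω'` is used.
    refine lintegral_congr fun ω₀ => ?_
    have hstep := lintegral_renewal_step (lam := lam) (P' := P') hg hU hf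
      (p := fun q => (p q : ℝ≥0∞)) (by fun_prop) (r := r) (b := fun t => β (t, ω₀)) (by fun_prop)
      (hpast n) (hgU n) (hlawg n) (hlawU n)
      (K := fun q => K n ((q.1.1, (ω₀, q.1.2)), q.2)) (by have := hK n; fun_prop)
    refine Eq.trans (lintegral_congr fun ω => ?_) (hstep.trans (lintegral_congr fun ω => ?_))
    · exact hHK n _ (ω₀, ω) _ le_rfl
    · refine setLIntegral_congr_fun measurableSet_Ioc fun t ht => lintegral_congr fun a => ?_
      rw [hHK n t (ω₀, ω) a ht.2]

end Compensator

/-! ### Rounding to a shifted time grid. -/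

section Grid

/-- The largest point of the grid `h ℤ` that is smaller than `x`. -/
noncomputable def gridFloor (h x : ℝ) : ℝ := h * (⌈x / h⌉ - 1)

lemma measurable_gridFloor (h : ℝ) : Measurable (gridFloor h) := by
  have : Measurable fun x : ℝ => ((⌈x / h⌉ : ℤ) : ℝ) :=
    measurable_from_top.comp (Int.measurable_ceil.comp (measurable_id.div_const h))
  exact (this.sub_const 1).const_mul h

lemma gridFloor_lt {h : ℝ} (hh : 0 < h) (x : ℝ) : gridFloor h x < x := by
  have h1 : (⌈x / h⌉ : ℝ) < x / h + 1 := Int.ceil_lt_add_one _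
  have h2 : h * (⌈x / h⌉ - 1) < h * (x / h) := mul_lt_mul_of_pos_left (by linarith) hh
  rwa [mul_div_cancel₀ _ hh.ne'] at h2

lemma le_gridFloor_add {h : ℝ} (hh : 0 < h) (x : ℝ) : x ≤ gridFloor h x + h := by
  have h1 : x / h ≤ ⌈x / h⌉ := Int.le_ceil _
  have h2 : h * (x / h) ≤ h * ⌈x / h⌉ := mul_le_mul_of_nonneg_left h1 hh.le
  rw [mul_div_cancel₀ _ hh.ne'] at h2
  rw [gridFloor]
  linarith

lemma gridFloor_eq_of_mem {h : ℝ} (hh : 0 < h) {x : ℝ} {m : ℤ} (h1 : h * (m - 1) < x)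
    (h2 : x ≤ h * m) : ⌈x / h⌉ = m := by
  rw [Int.ceil_eq_iff]
  constructor
  · rw [lt_div_iff₀ hh]; linarith
  · rw [div_le_iff₀ hh]; linarith

/-- Rounding is constant on left-open right-closed cells; this is the source of the constancy of `β`
between `τ t` and `t`. -/
lemma gridFloor_congr {h : ℝ} (hh : 0 < h) {x y : ℝ} (h1 : gridFloor h x < y) (h2 : y ≤ x) :
    gridFloor h y = gridFloor h x := by
  have h3 := le_gridFloor_add hh x
  rw [gridFloor] at h1 h3
  rw [gridFloor, gridFloor_eq_of_mem hh h1 (by linarith), gridFloor]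

lemma sub_gridFloor_of_mem {h : ℝ} (hh : 0 < h) {x : ℝ} (hx : x ∈ Set.Ioc 0 h) :
    x - gridFloor h x = x := by
  rw [gridFloor, gridFloor_eq_of_mem (m := 1) hh (by simpa using hx.1) (by simpa using hx.2)]
  simp

lemma sub_gridFloor_add_int_mul {h : ℝ} (hh : 0 < h) (x : ℝ) (m : ℤ) :
    (m * h + x) - gridFloor h (m * h + x) = x - gridFloor h x := by
  have : (m * h + x) / h = m + x / h := by field_simp
  rw [gridFloor, this, Int.ceil_intCast_add, gridFloor]
  push_cast
  ring

lemma setLIntegral_comp_const_sub (h x : ℝ) (φ : ℝ → ℝ≥0∞) :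
    ∫⁻ v in Set.Ioc 0 h, φ (x - v) = ∫⁻ y in Set.Ioc (x - h) x, φ y := by
  have h1 : Set.Ioc 0 h = (fun v => x - v) ⁻¹' Set.Ico (x - h) x := by
    ext v
    simp only [Set.mem_Ioc, Set.mem_preimage, Set.mem_Ico]
    constructor <;> rintro ⟨_, _⟩ <;> constructor <;> linarith
  have h2 : MeasurePreserving (fun v => x - v) (volume : Measure ℝ) volume :=
    Measure.measurePreserving_sub_left _ x
  rw [h1, h2.setLIntegral_comp_preimage_emb ((MeasurableEquiv.subLeft x).measurableEmbedding),
    setLIntegral_congr Ico_ae_eq_Ioc]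

/-- The distance to the grid point below is periodic with period `h`. A uniform shift of the grid
therefore makes this distance uniform on `(0, h]`, whatever `t` is. -/
lemma setLIntegral_sub_gridFloor {h : ℝ} (hh : 0 < h) (t : ℝ) (φ : ℝ → ℝ≥0∞) :
    ∫⁻ s in Set.Ioc 0 h, φ (t - s - gridFloor h (t - s)) = ∫⁻ v in Set.Ioc 0 h, φ v := by
  rw [setLIntegral_comp_const_sub h t fun x => φ (x - gridFloor h x)]
  have h1 := isAddFundamentalDomain_Ioc hh (t - h)
  have h2 := isAddFundamentalDomain_Ioc hh 0
  rw [sub_add_cancel] at h1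
  rw [zero_add] at h2
  rw [h1.setLIntegral_eq h2]
  · refine setLIntegral_congr_fun measurableSet_Ioc fun v hv => ?_
    simp only [sub_gridFloor_of_mem hh hv]
  · rintro ⟨_, m, rfl⟩ x
    have := sub_gridFloor_add_int_mul hh x m
    simp only [AddSubgroup.vadd_def, vadd_eq_add, zsmul_eq_mul]
    rw [this]

end Grid

/-! ### Choosing a grid by averaging over shifts. -/

section Discretization

/-- This is Lebesgue differentiation: for integer values, the indicator of `J y ≠ J x` is at most
`|J y - J x|`. -/
lemma ae_tendsto_average_ne {J : ℝ → ℕ} (hJ : Measurable J) {K : ℕ} (hJK : ∀ x, J x ≤ K) :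
    ∀ᵐ x, Tendsto (fun n : ℕ => (∫⁻ v in Set.Ioc 0 (1 / ((n : ℝ) + 1)),
      {y | J y ≠ J x}.indicator (fun _ => (1 : ℝ≥0∞)) (x - v))
        / ENNReal.ofReal (1 / ((n : ℝ) + 1))) atTop (𝓝 0) := by
  let f : ℝ → ℝ := fun x => J x
  have hf : Measurable f := measurable_from_top.comp hJ
  have hloc : LocallyIntegrable f := by
    refine (locallyIntegrable_const (K : ℝ)).mono hf.aestronglyMeasurable (ae_of_all _ fun x => ?_)
    simpa [f] using hJK x
  filter_upwards [(IsUnifLocDoublingMeasure.vitaliFamily (volume : Measure ℝ)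
    1).ae_tendsto_lintegral_enorm_sub_div hloc] with x hx
  -- The backward window is a closed ball centred at its midpoint and not at `x`; the Vitali family
  -- allows such balls as long as they contain `x`.
  have h1 := IsUnifLocDoublingMeasure.tendsto_closedBall_filterAt (volume : Measure ℝ) (K := 1)
    (x := x) (l := atTop) (fun n : ℕ => x - (1 / ((n : ℝ) + 1)) / 2)
    (fun n : ℕ => (1 / ((n : ℝ) + 1)) / 2) ?_ ?_
  · refine tendsto_of_tendsto_of_tendsto_of_le_of_le tendsto_const_nhds (hx.comp h1)
      (fun _ => zero_le) fun n => ?_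
    have hball : Metric.closedBall (x - (1 / ((n : ℝ) + 1)) / 2) ((1 / ((n : ℝ) + 1)) / 2)
        = Set.Icc (x - 1 / ((n : ℝ) + 1)) x := by
      rw [Real.closedBall_eq_Icc]
      congr 1 <;> ring
    simp only [Function.comp_apply]
    rw [hball, Real.volume_Icc, sub_sub_cancel]
    refine ENNReal.div_le_div_right ?_ _
    rw [setLIntegral_comp_const_sub _ x]
    refine (lintegral_mono_set Set.Ioc_subset_Icc_self).trans (lintegral_mono fun y => ?_)
    by_cases h : J y = J x
    · simp [h]
    · rw [Set.indicator_of_mem (show y ∈ {y | J y ≠ J x} from h)]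
      have h2 : (1 : ℝ) ≤ ‖f y - f x‖ := by
        have : (1 : ℤ) ≤ |(J y : ℤ) - J x| := Int.one_le_abs (by omega)
        simp only [f, Real.norm_eq_abs]
        exact_mod_cast this
      rw [← ofReal_norm]
      exact ENNReal.one_le_ofReal.2 h2
  · refine tendsto_nhdsWithin_iff.2 ⟨?_, Eventually.of_forall fun n => ?_⟩
    · simpa using tendsto_one_div_add_atTop_nhds_zero_nat.div_const (2 : ℝ)
    · exact Set.mem_Ioi.2 (by positivity)
  · refine Eventually.of_forall fun n => ?_
    have : (0 : ℝ) ≤ 1 / ((n : ℝ) + 1) / 2 := by positivity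
    simp only [Metric.mem_closedBall, Real.dist_eq, sub_sub_cancel, one_mul, abs_of_nonneg this,
      le_refl]

/-- A bounded measurable integer-valued process is close to its delayed discretization along some
grid. -/
lemma exists_gridFloor_discretization {Ω : Type*} [MeasurableSpace Ω] (P : Measure Ω)
    [IsProbabilityMeasure P] {J : ℝ × Ω → ℕ} (hJ : Measurable J) {K : ℕ} (hJK : ∀ q, J q ≤ K)
    (T : ℝ) {ε : ℝ≥0∞} (hε : 0 < ε) :
    ∃ h > 0, ∃ s, ∫⁻ ω, ∫⁻ t in Set.Icc 0 T, {y | J (y, ω) ≠ J (t, ω)}.indicator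
      (fun _ => (1 : ℝ≥0∞)) (s + gridFloor h (t - s)) ∂volume ∂P < ε := by
  let φ : Ω × ℝ → ℝ → ℝ≥0∞ := fun q v =>
    {y | J (y, q.1) ≠ J (q.2, q.1)}.indicator (fun _ => (1 : ℝ≥0∞)) (q.2 - v)
  have hφ : Measurable fun q : (Ω × ℝ) × ℝ => φ q.1 q.2 := by
    have hS : MeasurableSet {q : (Ω × ℝ) × ℝ | J (q.1.2 - q.2, q.1.1) ≠ J (q.1.2, q.1.1)} :=
      (measurableSet_eq_fun (by fun_prop) (by fun_prop)).compl
    exact (measurable_const (a := (1 : ℝ≥0∞))).indicator hS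
  have hφ1 : ∀ q v, φ q v ≤ 1 := fun q v => Set.indicator_le_self' (fun _ _ => zero_le) _
  let hn : ℕ → ℝ := fun n => 1 / ((n : ℝ) + 1)
  have hn0 : ∀ n, 0 < hn n := fun n => by positivity
  let μ : Measure (Ω × ℝ) := P.prod (volume.restrict (Set.Icc 0 T))
  let D : ℕ → Ω × ℝ → ℝ≥0∞ := fun n q =>
    (∫⁻ v in Set.Ioc 0 (hn n), φ q v) / ENNReal.ofReal (hn n)
  have hDm : ∀ n, Measurable (D n) := fun n => hφ.lintegral_prod_right'.div_const _
  have hD1 : ∀ n q, D n q ≤ 1 := fun n q => by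
    refine ENNReal.div_le_of_le_mul ?_
    refine (lintegral_mono (g := fun _ => 1) fun v => hφ1 q v).trans ?_
    simp
  have hDlim : Tendsto (fun n => ∫⁻ q, D n q ∂μ) atTop (𝓝 0) := by
    rw [← lintegral_zero (μ := μ)]
    refine tendsto_lintegral_of_dominated_convergence (fun _ => 1) hDm
      (fun n => ae_of_all _ (hD1 n)) (by simp) ?_
    have hset : MeasurableSet {q : Ω × ℝ | Tendsto (fun n => D n q) atTop (𝓝 0)} :=
      measurableSet_tendsto _ hDm
    refine (Measure.ae_prod_iff_ae_ae hset).2 (ae_of_all _ fun ω => ae_restrict_of_ae ?_)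
    exact ae_tendsto_average_ne (J := fun y => J (y, ω)) (by fun_prop) fun x => hJK _
  obtain ⟨n, hnε⟩ := (hDlim.eventually_lt_const hε).exists
  refine ⟨hn n, hn0 n, ?_⟩
  -- If every shift had error at least `ε`, so would the average over shifts in `(0, h]`. That
  -- average is the mean of `D n`, which is below `ε`.
  by_contra! hcon
  have h1 : ∫⁻ s in Set.Ioc 0 (hn n), ∫⁻ ω, ∫⁻ t in Set.Icc 0 T,
      {y | J (y, ω) ≠ J (t, ω)}.indicator (fun _ => (1 : ℝ≥0∞)) (s + gridFloor (hn n) (t - s))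
      ∂volume ∂P
      = ENNReal.ofReal (hn n) * ∫⁻ q, D n q ∂μ := by
    have hg := measurable_gridFloor (hn n)
    -- The rounded time is `t` minus its distance to the shifted grid, so averaging over `s`
    -- produces the backward average in `D`.
    have e1 : ∀ s ω t, {y | J (y, ω) ≠ J (t, ω)}.indicator (fun _ => (1 : ℝ≥0∞))
        (s + gridFloor (hn n) (t - s)) = φ (ω, t) (t - s - gridFloor (hn n) (t - s)) :=
      fun s ω t => by
        simp only [φ]
        congr 1
        ring
    have hmeas : Measurable fun q : ℝ × (Ω × ℝ) =>
        φ q.2 (q.2.2 - q.1 - gridFloor (hn n) (q.2.2 - q.1)) :=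
      hφ.comp (measurable_snd.prodMk (by fun_prop))
    simp only [e1]
    have e2 : ∀ s, ∫⁻ ω, ∫⁻ t in Set.Icc 0 T, φ (ω, t) (t - s - gridFloor (hn n) (t - s)) ∂volume ∂P
        = ∫⁻ q, φ q (q.2 - s - gridFloor (hn n) (q.2 - s)) ∂μ := fun s =>
      (lintegral_prod _ (hmeas.comp measurable_prodMk_left).aemeasurable).symm
    simp only [e2]
    rw [lintegral_lintegral_swap hmeas.aemeasurable, ← lintegral_const_mul _ (hDm n)]
    refine lintegral_congr fun q => ?_
    rw [setLIntegral_sub_gridFloor (hn0 n), ENNReal.mul_div_cancel]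
    · exact (ENNReal.ofReal_pos.2 (hn0 n)).ne'
    · exact ENNReal.ofReal_ne_top
  have h2 : ENNReal.ofReal (hn n) * ε ≤ ENNReal.ofReal (hn n) * ∫⁻ q, D n q ∂μ := by
    rw [← h1]
    calc ENNReal.ofReal (hn n) * ε = ∫⁻ _ in Set.Ioc 0 (hn n), ε := by simp [mul_comm]
      _ ≤ _ := lintegral_mono fun s => hcon s
  exact (ENNReal.mul_lt_mul_right (ENNReal.ofReal_pos.2 (hn0 n)).ne' ENNReal.ofReal_ne_top
    hnε).not_ge h2

end Discretization

/-! ### Approximation of progressive processes by predictable step processes. -/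

section StepApproximation

variable {Ω A : Type*} {mΩ : MeasurableSpace Ω}

/-- On each cell the process is frozen at the value at the left end `u`. This value is known at time
`u`, and the cell lies in `Set.Ioi u`, so a predictable generator appears. -/
lemma measurable_predictable_gridFloor (G : Filtration ℝ≥0 mΩ) {h : ℝ} (hh : 0 < h) (s : ℝ)
    {J : ℝ × Ω → ℕ} (hJ0 : ∀ x < 0, ∀ ω, J (x, ω) = 0)
    (hJ : ∀ u : ℝ≥0, Measurable[G u] fun ω => J (u, ω)) :
    Measurable[G.predictable] fun q : ℝ≥0 × Ω => J (s + gridFloor h (q.1 - s), q.2) := by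
  let : MeasurableSpace (ℝ≥0 × Ω) := G.predictable
  have hceil : Measurable fun q : ℝ≥0 × Ω => ⌈((q.1 : ℝ) - s) / h⌉ :=
    Int.measurable_ceil.comp
      (((measurable_predictable_fst G).coe_nnreal_real.sub_const s).div_const h)
  intro C _
  have key : (fun q : ℝ≥0 × Ω => J (s + gridFloor h (q.1 - s), q.2)) ⁻¹' C
      = ⋃ m : ℤ, {q | ⌈((q.1 : ℝ) - s) / h⌉ = m} ∩ {q | J (s + h * (m - 1), q.2) ∈ C} := by
    ext q
    simp [gridFloor]
  rw [key]
  refine MeasurableSet.iUnion fun m => ?_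
  have hm : MeasurableSet {q : ℝ≥0 × Ω | ⌈((q.1 : ℝ) - s) / h⌉ = m} :=
    hceil (measurableSet_singleton m)
  -- A cell whose left end precedes time zero carries the constant index 0 and needs no information.
  rcases lt_or_ge (s + h * (m - 1)) 0 with hneg | hpos
  · simp only [hJ0 _ hneg]
    exact hm.inter (MeasurableSet.const _)
  · lift s + h * (m - 1) to ℝ≥0 using hpos with u hu
    have h1 : {q : ℝ≥0 × Ω | ⌈((q.1 : ℝ) - s) / h⌉ = m} ∩ {q | J (u, q.2) ∈ C}
        = {q : ℝ≥0 × Ω | ⌈((q.1 : ℝ) - s) / h⌉ = m} ∩ Set.Ioi u ×ˢ {ω | J (u, ω) ∈ C} := by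
      ext q
      simp only [Set.mem_inter_iff, Set.mem_ofPred_eq, Set.mem_prod, Set.mem_Ioi]
      refine and_congr_right fun hq => ⟨fun h' => ⟨?_, h'⟩, fun h' => h'.2⟩
      have := gridFloor_lt hh ((q.1 : ℝ) - s)
      rw [gridFloor, hq] at this
      rw [← NNReal.coe_lt_coe, hu]
      linarith
    rw [h1]
    exact hm.inter (measurableSet_predictable_Ioi_prod (hJ u (MeasurableSet.of_discrete (s := C))))

lemma IsProgressiveUpTo.exists_measurable_extension [MeasurableSpace A] [Nonempty A]
    {G : Filtration ℝ≥0 mΩ} {T : ℝ≥0} {α : ℝ≥0 → Ω → A} (hα : IsProgressiveUpTo G T α) :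
    ∃ αe : ℝ≥0 × Ω → A, Measurable αe ∧ ∀ t ≤ T, ∀ ω, αe (t, ω) = α t ω := by
  have hemb : MeasurableEmbedding fun p : Set.Iic T × Ω => ((p.1 : ℝ≥0), p.2) :=
    (MeasurableEmbedding.subtype_coe measurableSet_Iic).prodMap MeasurableEmbedding.id
  obtain ⟨αe, hαe, hext⟩ := hemb.exists_measurable_extend
    ((hα T le_rfl).mono (sup_le_sup le_rfl (MeasurableSpace.comap_mono (G.le T))) le_rfl)
    fun _ => inferInstance
  exact ⟨αe, hαe, fun t ht ω => congr_fun hext (⟨t, ht⟩, ω)⟩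

variable [MetricSpace A] [MeasurableSpace A] [BorelSpace A] [SecondCountableTopology A]

/-- Progressive processes are close to predictable processes with finitely many values that are
constant on left-open right-closed time intervals. -/
theorem exists_predictable_step_approx (hρ : ∀ a b : A, dist a b < 1) (a₀ : A) (P : Measure Ω)
    [IsProbabilityMeasure P] (G : Filtration ℝ≥0 mΩ) {T : ℝ≥0} {α : ℝ≥0 → Ω → A}
    (hα : IsProgressiveUpTo G T α) {ε : ℝ≥0∞} (hε : 0 < ε) :
    ∃ (β : ℝ≥0 × Ω → A) (τ : ℝ≥0 → ℝ≥0), Measurable[G.predictable] β ∧ (Set.range β).Finite ∧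
      Measurable τ ∧ (∀ t, 0 < t → τ t < t) ∧
      (∀ t s ω, τ t < s → s ≤ t → β (s, ω) = β (t, ω)) ∧
      krylovDist P T (fun t ω => β (t, ω)) α < ε := by
  have hne : Nonempty A := ⟨a₀⟩
  let e : ℕ → A := TopologicalSpace.denseSeq A
  obtain ⟨αe, hαe, hαe'⟩ := hα.exists_measurable_extension
  let μ : Measure (Ω × ℝ≥0) := P.prod (timeMeasure.restrict (Set.Iic T))
  -- Projection onto finitely many points of a dense sequence has vanishing error, by dominated
  -- convergence with `dist < 1`.
  have hlim : Tendsto (fun K => ∫⁻ q, ENNReal.ofReal (dist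
      (SimpleFunc.nearestPt e K (αe (q.2, q.1))) (αe (q.2, q.1))) ∂μ) atTop (𝓝 0) := by
    rw [← lintegral_zero (μ := μ)]
    refine tendsto_lintegral_of_dominated_convergence (fun _ => 1) (fun K => ?_)
      (fun K => ae_of_all _ fun q => ?_) ?_ (ae_of_all _ fun q => ?_)
    · have := (SimpleFunc.nearestPt e K).measurable
      fun_prop
    · exact ENNReal.ofReal_le_one.2 (hρ _ _).le
    · simp [μ, timeMeasure_Iic, ← Set.univ_prod_univ]
    · have h1 := SimpleFunc.tendsto_nearestPt (e := e) (x := αe (q.2, q.1))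
        (by rw [(TopologicalSpace.denseRange_denseSeq A).closure_range]; trivial)
      rw [tendsto_iff_dist_tendsto_zero] at h1
      simpa using ENNReal.tendsto_ofReal h1
  obtain ⟨K, hK⟩ := (hlim.eventually_lt_const (ENNReal.half_pos hε.ne')).exists
  classical
  -- Discretization acts on the index of the nearest point, which is bounded and integer-valued; the
  -- index is 0 outside `[0, T]`.
  let J : ℝ × Ω → ℕ := fun q => if q.1 ∈ Set.Icc (0 : ℝ) T then
    SimpleFunc.nearestPtInd e K (αe (q.1.toNNReal, q.2)) else 0
  have hJm : Measurable J := by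
    have := (SimpleFunc.nearestPtInd e K).measurable
    exact Measurable.ite (measurable_fst measurableSet_Icc) (by fun_prop) measurable_const
  have hJK : ∀ q, J q ≤ K := fun q => by
    simp only [J]
    split_ifs
    · exact SimpleFunc.nearestPtInd_le e K _
    · exact zero_le
  have hJ0 : ∀ x < 0, ∀ ω, J (x, ω) = 0 := fun x hx ω => if_neg fun h => hx.not_ge h.1
  have hJG : ∀ u : ℝ≥0, Measurable[G u] fun ω => J (u, ω) := fun u => by
    by_cases hu : u ≤ T
    · have h1 : (fun ω => J (u, ω)) = fun ω => SimpleFunc.nearestPtInd e K (α u ω) := by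
        ext ω
        have : (u : ℝ) ∈ Set.Icc (0 : ℝ) T := ⟨u.coe_nonneg, NNReal.coe_le_coe.2 hu⟩
        simp only [J, if_pos this, Real.toNNReal_coe, hαe' u hu]
      rw [h1]
      have h2 : Measurable[G u] (α u) := by
        let : MeasurableSpace Ω := G u
        exact (hα u hu).comp (measurable_prodMk_left (x := (⟨u, Set.self_mem_Iic⟩ : Set.Iic u)))
      exact (SimpleFunc.nearestPtInd e K).measurable.comp h2
    · have h1 : (fun ω => J (u, ω)) = fun _ => 0 := by
        ext ω
        exact if_neg fun h => hu (NNReal.coe_le_coe.1 h.2)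
      rw [h1]
      exact measurable_const
  obtain ⟨h, hh, s, hs⟩ := exists_gridFloor_discretization P hJm hJK (T : ℝ)
    (ENNReal.half_pos hε.ne')
  have hem : Measurable e := measurable_from_top
  have hpred := hem.comp (measurable_predictable_gridFloor G hh s hJ0 hJG)
  -- The cell's left end is clamped at 0, which keeps it strictly below every positive `t`.
  refine ⟨_, fun t => (s + gridFloor h (t - s)).toNNReal, hpred, ?_, ?_, ?_, ?_, ?_⟩
  · refine ((Finset.range (K + 1)).finite_toSet.image e).subset ?_
    rintro _ ⟨q, rfl⟩
    exact ⟨_, Finset.mem_coe.2 (Finset.mem_range_succ_iff.2 (hJK _)), rfl⟩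
  · have := measurable_gridFloor h
    fun_prop
  · intro t ht
    have := gridFloor_lt hh ((t : ℝ) - s)
    rw [← NNReal.coe_lt_coe, Real.coe_toNNReal', max_lt_iff]
    exact ⟨by linarith, ht⟩
  · intro t u ω hu hut
    have h1 : s + gridFloor h (t - s) < u := by
      have h2 : s + gridFloor h (t - s) ≤ ((s + gridFloor h (t - s)).toNNReal : ℝ) :=
        Real.le_coe_toNNReal _
      exact h2.trans_lt (NNReal.coe_lt_coe.2 hu)
    have h2 : (u : ℝ) ≤ t := NNReal.coe_le_coe.2 hut
    simp only [Function.comp_apply]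
    rw [gridFloor_congr hh (x := t - s) (y := u - s) (by linarith) (by linarith)]
  -- Equal indices leave only the projection error; unequal ones cost at most 1.
  · have hbound : ∀ ω, ∀ t ∈ Set.Iic T, ENNReal.ofReal (dist
        ((e ∘ fun q : ℝ≥0 × Ω => J (s + gridFloor h (q.1 - s), q.2)) (t, ω)) (α t ω))
        ≤ {y | J (y, ω) ≠ J (t, ω)}.indicator (fun _ => (1 : ℝ≥0∞)) (s + gridFloor h (t - s))
          + ENNReal.ofReal (dist (SimpleFunc.nearestPt e K (αe (t, ω))) (αe (t, ω))) := by
      intro ω t ht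
      simp only [Function.comp_apply]
      by_cases h1 : J (s + gridFloor h (t - s), ω) = J (t, ω)
      · have h2 : (t : ℝ) ∈ Set.Icc (0 : ℝ) T := ⟨t.coe_nonneg, NNReal.coe_le_coe.2 ht⟩
        have h3 : e (J (t, ω)) = SimpleFunc.nearestPt e K (αe (t, ω)) := by
          simp only [J, if_pos h2, Real.toNNReal_coe]
          rfl
        rw [h1, h3, hαe' t ht]
        exact le_add_self
      · rw [Set.indicator_of_mem (show _ ∈ {y | J (y, ω) ≠ J (t, ω)} from h1)]
        exact (ENNReal.ofReal_le_one.2 (hρ _ _).le).trans le_self_add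
    have hm1 : Measurable fun q : Ω × ℝ≥0 => {y | J (y, q.1) ≠ J ((q.2 : ℝ), q.1)}.indicator
        (fun _ => (1 : ℝ≥0∞)) (s + gridFloor h (q.2 - s)) := by
      have := measurable_gridFloor h
      have hS : MeasurableSet
          {q : Ω × ℝ≥0 | J (s + gridFloor h (q.2 - s), q.1) ≠ J ((q.2 : ℝ), q.1)} :=
        (measurableSet_eq_fun (by fun_prop) (by fun_prop)).compl
      exact (measurable_const (a := (1 : ℝ≥0∞))).indicator hS
    have hm2 : Measurable fun q : Ω × ℝ≥0 => ENNReal.ofReal (dist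
        (SimpleFunc.nearestPt e K (αe (q.2, q.1))) (αe (q.2, q.1))) := by
      have := (SimpleFunc.nearestPt e K).measurable
      fun_prop
    have h1 : ∫⁻ ω, ∫⁻ t in Set.Iic T, {y | J (y, ω) ≠ J ((t : ℝ), ω)}.indicator
        (fun _ => (1 : ℝ≥0∞)) (s + gridFloor h (t - s)) ∂timeMeasure ∂P < ε / 2 := by
      refine lt_of_eq_of_lt (lintegral_congr fun ω => ?_) hs
      rw [← image_coe_nnreal_Iic]
      exact setLIntegral_timeMeasure fun t => {y | J (y, ω) ≠ J (t, ω)}.indicator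
        (fun _ => (1 : ℝ≥0∞)) (s + gridFloor h (t - s))
    rw [lintegral_prod _ hm2.aemeasurable] at hK
    calc krylovDist P T _ α ≤ ∫⁻ ω, ∫⁻ t in Set.Iic T,
          ({y | J (y, ω) ≠ J (t, ω)}.indicator (fun _ => (1 : ℝ≥0∞)) (s + gridFloor h (t - s))
          + ENNReal.ofReal (dist (SimpleFunc.nearestPt e K (αe (t, ω))) (αe (t, ω))))
            ∂timeMeasure ∂P :=
          lintegral_mono fun ω => setLIntegral_mono' measurableSet_Iic (hbound ω)
      _ = _ := by
          refine Eq.trans (lintegral_congr fun ω => lintegral_add_left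
            (hm1.comp measurable_prodMk_left) _) (lintegral_add_left hm1.lintegral_prod_right' _)
      _ < ε / 2 + ε / 2 := ENNReal.add_lt_add h1 hK
      _ = ε := ENNReal.add_halves ε

end StepApproximation

/-! ### Separating the past from the next gap and uniform variable. -/

section Independence

/-- On rectangles both sides factor into the same four probabilities. This regroups independence of
gaps from uniform variables into independence of past from present. -/
lemma ProbabilityTheory.IndepFun.prodMk_prodMk_of_indepFun {Ω α₁ α₂ α₃ α₄ : Type*} [MeasurableSpace Ω]
    [MeasurableSpace α₁] [MeasurableSpace α₂] [MeasurableSpace α₃] [MeasurableSpace α₄]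
    {P : Measure Ω} [IsProbabilityMeasure P] {a : Ω → α₁} {b : Ω → α₂} {c : Ω → α₃} {d : Ω → α₄}
    (ha : Measurable a) (hb : Measurable b) (hc : Measurable c) (hd : Measurable d)
    (hab : IndepFun a b P) (hcd : IndepFun c d P)
    (h : IndepFun (fun ω => (a ω, b ω)) (fun ω => (c ω, d ω)) P) :
    IndepFun (fun ω => (a ω, c ω)) (fun ω => (b ω, d ω)) P := by
  have hac : IndepFun a c P := h.comp measurable_fst measurable_fst
  have hbd : IndepFun b d P := h.comp measurable_snd measurable_snd
  rw [IndepFun_iff_Indep]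
  refine IndepSets.indep (ha.prodMk hc).comap_le (hb.prodMk hd).comap_le
    (isPiSystem_prod.comap fun ω => (a ω, c ω)) (isPiSystem_prod.comap fun ω => (b ω, d ω))
    (by rw [← generateFrom_prod, MeasurableSpace.comap_generateFrom]; rfl)
    (by rw [← generateFrom_prod, MeasurableSpace.comap_generateFrom]; rfl) ?_
  rw [IndepSets_iff]
  rintro _ _ ⟨_, ⟨s₁, hs₁, s₃, hs₃, rfl⟩, rfl⟩ ⟨_, ⟨s₂, hs₂, s₄, hs₄, rfl⟩, rfl⟩
  have e1 := h.measure_inter_preimage_eq_mul _ _ (MeasurableSet.prod hs₁ hs₂)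
    (MeasurableSet.prod hs₃ hs₄)
  have e2 := hab.measure_inter_preimage_eq_mul _ _ hs₁ hs₂
  have e3 := hcd.measure_inter_preimage_eq_mul _ _ hs₃ hs₄
  have e4 := hac.measure_inter_preimage_eq_mul _ _ hs₁ hs₃
  have e5 := hbd.measure_inter_preimage_eq_mul _ _ hs₂ hs₄
  simp only [Set.mk_preimage_prod] at e1 ⊢
  rw [e4, e5, Set.inter_inter_inter_comm, e1, e2, e3]
  ring

lemma indepFun_renewalPast {Ω' : Type*} [MeasurableSpace Ω'] {P' : Measure Ω'}
    [IsProbabilityMeasure P'] {g : ℕ → Ω' → ℝ≥0} {U : ℕ → Ω' → ℝ}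
    (hg : ∀ n, Measurable (g n)) (hU : ∀ n, Measurable (U n)) (hig : iIndepFun g P')
    (hiU : iIndepFun U P') (hgU : IndepFun (fun ω n => g n ω) (fun ω n => U n ω) P') (n : ℕ) :
    IndepFun (renewalPast g U n) (fun ω => (g n ω, U n ω)) P' := by
  have hdisj : Disjoint (Finset.range n) {n} := by simp
  have e : n ∈ ({n} : Finset ℕ) := Finset.mem_singleton_self n
  have h1 : IndepFun (fun ω (j : Finset.range n) => g j ω) (g n) P' :=
    (hig.indepFun_finset (Finset.range n) {n} hdisj hg).comp measurable_id
      (measurable_pi_apply (⟨n, e⟩ : ({n} : Finset ℕ)))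
  have h2 : IndepFun (fun ω (j : Finset.range n) => U j ω) (U n) P' :=
    (hiU.indepFun_finset (Finset.range n) {n} hdisj hU).comp measurable_id
      (measurable_pi_apply (⟨n, e⟩ : ({n} : Finset ℕ)))
  have h3 : IndepFun (fun ω => ((fun j : Finset.range n => g j ω), g n ω))
      (fun ω => ((fun j : Finset.range n => U j ω), U n ω)) P' :=
    hgU.comp (φ := fun x => ((fun j : Finset.range n => x j), x n))
      (ψ := fun x => ((fun j : Finset.range n => x j), x n)) (by fun_prop) (by fun_prop)
  have h4 := IndepFun.prodMk_prodMk_of_indepFun (by fun_prop) (hg n) (by fun_prop) (hU n) h1 h2 h3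
  exact h4.comp (φ := fun x (j : Finset.range n) => (x.1 j, x.2 j)) (by fun_prop) measurable_id

end Independence

/-! ### The exponential law and its constant hazard rate. -/

section Exponential

lemma expMeasure_Ioi {r : ℝ} (hr : 0 < r) {x : ℝ} (hx : 0 ≤ x) :
    expMeasure r (Set.Ioi x) = ENNReal.ofReal (Real.exp (-(r * x))) := by
  have := isProbabilityMeasure_expMeasure hr
  rw [← Set.compl_Iic, prob_compl_eq_one_sub measurableSet_Iic, ← ofReal_cdf,
    cdf_expMeasure_eq hr, if_pos hx, ← ENNReal.ofReal_one, ← ENNReal.ofReal_sub]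
  · congr 1; ring
  · rw [sub_nonneg, Real.exp_le_one_iff]
    nlinarith

lemma lintegral_expMeasure {r : ℝ} {φ : ℝ → ℝ≥0∞} (hφ : Measurable φ) :
    ∫⁻ x, φ x ∂expMeasure r
      = ∫⁻ x in Set.Ici 0, ENNReal.ofReal (r * Real.exp (-(r * x))) * φ x := by
  have h : expMeasure r = (volume : Measure ℝ).withDensity (exponentialPDF r) := rfl
  have hpdf : Measurable (exponentialPDF r) := (measurable_exponentialPDFReal r).ennreal_ofReal
  rw [h, lintegral_withDensity_eq_lintegral_mul _ hpdf hφ, ← lintegral_indicator measurableSet_Ici]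
  refine lintegral_congr fun x => ?_
  by_cases hx : 0 ≤ x
  · rw [Set.indicator_of_mem (show x ∈ Set.Ici (0 : ℝ) from hx), Pi.mul_apply,
      exponentialPDF_of_nonneg hx]
  · rw [Set.indicator_of_notMem (show x ∉ Set.Ici (0 : ℝ) from hx), Pi.mul_apply,
      exponentialPDF_of_neg (not_le.1 hx), zero_mul]

/-- By Tonelli the right side integrates `r * φ t` against the tail probability `exp (-(r * t))`,
and `r * exp (-(r * t))` is the density. -/
lemma lintegral_exponential_eq {r : ℝ} (hr : 0 < r) {φ : ℝ → ℝ≥0∞} (hφ : Measurable φ) :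
    ∫⁻ x, φ x ∂expMeasure r
      = ∫⁻ x, ∫⁻ t in Set.Ioc 0 x, ENNReal.ofReal r * φ t ∂volume ∂expMeasure r := by
  have := isProbabilityMeasure_expMeasure hr
  have hS : MeasurableSet {q : ℝ × ℝ | q.2 < q.1} := measurableSet_lt measurable_snd measurable_fst
  have h1 : ∀ x, ∫⁻ t in Set.Ioc 0 x, ENNReal.ofReal r * φ t
      = ∫⁻ t in Set.Ici 0, {q : ℝ × ℝ | q.2 < q.1}.indicator
        (fun q => ENNReal.ofReal r * φ q.2) (x, t) := fun x => by
    rw [← setLIntegral_congr Ico_ae_eq_Ioc, ← Set.Ici_inter_Iio, Set.inter_comm,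
      ← setLIntegral_indicator measurableSet_Iio]
    rfl
  have hm : Measurable ({q : ℝ × ℝ | q.2 < q.1}.indicator fun q => ENNReal.ofReal r * φ q.2) :=
    Measurable.indicator (by fun_prop) hS
  simp only [h1]
  rw [lintegral_lintegral_swap
      (f := fun x t => {q : ℝ × ℝ | q.2 < q.1}.indicator (fun q => ENNReal.ofReal r * φ q.2) (x, t))
      hm.aemeasurable,
    lintegral_expMeasure hφ]
  refine setLIntegral_congr_fun measurableSet_Ici fun t ht => ?_
  have h2 : ∀ x, {q : ℝ × ℝ | q.2 < q.1}.indicator (fun q => ENNReal.ofReal r * φ q.2) (x, t)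
      = (Set.Ioi t).indicator (fun _ => ENNReal.ofReal r * φ t) x := fun x => rfl
  simp only [h2]
  rw [lintegral_indicator_const measurableSet_Ioi, expMeasure_Ioi hr ht,
    ENNReal.ofReal_mul hr.le]
  ring

/-- Integration against the law of `c X`, `X` exponential, in terms of its intensity. -/
lemma lintegral_const_mul_exponential {Ω' : Type*} [MeasurableSpace Ω'] {P' : Measure Ω'}
    {r c : ℝ≥0} (hr : 0 < r) (hc : 0 < c) {X : Ω' → ℝ≥0}
    (hX : HasLaw (fun ω => (X ω : ℝ)) (expMeasure r) P') {φ : ℝ≥0 → ℝ≥0∞} (hφ : Measurable φ) :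
    ∫⁻ ω, φ (c * X ω) ∂P'
      = ∫⁻ ω, ∫⁻ t in Set.Ioc 0 (c * X ω), ((r / c : ℝ≥0) : ℝ≥0∞) * φ t ∂timeMeasure ∂P' := by
  have hm : Measurable fun x : ℝ => φ (c * x.toNNReal) := by fun_prop
  have h1 : ∀ x : ℝ≥0, ∫⁻ t in Set.Ioc 0 (c * x), ((r / c : ℝ≥0) : ℝ≥0∞) * φ t ∂timeMeasure
      = ∫⁻ t in Set.Ioc (0 : ℝ) x, ENNReal.ofReal r * φ (c * t.toNNReal) := fun x => by
    have h2 := setLIntegral_timeMeasure_Ioc_add 0 (c * x)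
      (ψ := fun t => ((r / c : ℝ≥0) : ℝ≥0∞) * φ t)
    simp only [zero_add] at h2
    have hc' : (c : ℝ) ≠ 0 := by exact_mod_cast hc.ne'
    have h3 : Set.Ioc (0 : ℝ) x = (fun t => (c : ℝ) * t) ⁻¹' Set.Ioc (0 : ℝ) ((c * x : ℝ≥0) : ℝ) := by
      ext t
      have : (0 : ℝ) < c := by exact_mod_cast hc
      simp [this, mul_div_cancel_left₀ _ hc']
    have h4 : (volume : Measure ℝ) = ENNReal.ofReal |(c : ℝ)| • (volume : Measure ℝ).map ((c : ℝ) * ·) := by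
      rw [Real.smul_map_volume_mul_left hc']
    rw [h2]
    conv_lhs => rw [h4]
    rw [Measure.restrict_smul, lintegral_smul_measure,
      (measurableEmbedding_mulLeft₀ hc').restrict_map,
      (measurableEmbedding_mulLeft₀ hc').lintegral_map, ← h3, smul_eq_mul, ← lintegral_const_mul]
    · refine lintegral_congr fun t => ?_
      rw [Real.toNNReal_mul c.coe_nonneg, Real.toNNReal_coe, ← mul_assoc, abs_of_nonneg c.coe_nonneg,
        ENNReal.ofReal_coe_nnreal, ENNReal.ofReal_coe_nnreal, ← ENNReal.coe_mul,
        mul_div_cancel₀ _ hc.ne']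
    · fun_prop
  have h5 := lintegral_exponential_eq (r := r) (by exact_mod_cast hr) hm
  have hm2 : Measurable fun x : ℝ =>
      ∫⁻ t in Set.Ioc (0 : ℝ) x, ENNReal.ofReal r * φ (c * t.toNNReal) := by
    have : ∀ x : ℝ, ∫⁻ t in Set.Ioc (0 : ℝ) x, ENNReal.ofReal r * φ (c * t.toNNReal)
        = ∫⁻ t, ({q : ℝ × ℝ | 0 < q.2} ∩ {q : ℝ × ℝ | q.2 ≤ q.1}).indicator
          (fun q => ENNReal.ofReal r * φ (c * q.2.toNNReal)) (x, t) := fun x => by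
      rw [← lintegral_indicator measurableSet_Ioc]
      rfl
    simp only [this]
    refine Measurable.lintegral_prod_right' (Measurable.indicator (by fun_prop) ?_)
    exact (measurableSet_lt measurable_const measurable_snd).inter
      (measurableSet_le measurable_snd measurable_fst)
  rw [← hX.map_eq, lintegral_map' hm.aemeasurable hX.aemeasurable,
    lintegral_map' hm2.aemeasurable hX.aemeasurable] at h5
  simp only [h1]
  simpa using h5

lemma integrable_id_expMeasure {r : ℝ} (hr : 0 < r) : Integrable (fun x : ℝ => x) (expMeasure r) := by
  have h : expMeasure r = (volume : Measure ℝ).withDensity (exponentialPDF r) := rfl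
  have hpdf : Measurable (exponentialPDF r) := (measurable_exponentialPDFReal r).ennreal_ofReal
  rw [h, integrable_withDensity_iff_integrable_smul' hpdf
    (ae_of_all _ fun x => ENNReal.ofReal_lt_top)]
  have h1 : (fun x : ℝ => (exponentialPDF r x).toReal • x)
      = (Set.Ioi 0).indicator fun x => r * (x ^ (1 : ℝ) * Real.exp (-r * x)) := by
    ext x
    rcases le_or_gt x 0 with hx | hx
    · rw [Set.indicator_of_notMem (by simpa using hx)]
      rcases hx.eq_or_lt with rfl | hx
      · simp
      · simp [exponentialPDF_of_neg hx]
    · rw [Set.indicator_of_mem (show x ∈ Set.Ioi (0 : ℝ) from hx), exponentialPDF_of_nonneg hx.le,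
        ENNReal.toReal_ofReal (by positivity), Real.rpow_one, smul_eq_mul, neg_mul]
      ring
  rw [h1, integrable_indicator_iff measurableSet_Ioi]
  have h2 := integrableOn_rpow_mul_exp_neg_mul_rpow (s := 1) (p := 1) (by norm_num) one_pos hr
  simp only [Real.rpow_one] at h2 ⊢
  exact h2.const_mul r

end Exponential

/-! ### Mark densities concentrated near a given point. -/

section MarkDensity

lemma lintegral_Ioo_projIcc (φ : unitInterval → ℝ≥0∞) :
    ∫⁻ u in Set.Ioo (0 : ℝ) 1, φ (Set.projIcc 0 1 zero_le_one u) = ∫⁻ x, φ x := by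
  have h : MeasurableEmbedding ((↑) : unitInterval → ℝ) :=
    MeasurableEmbedding.subtype_coe measurableSet_Icc
  have h1 : (volume : Measure unitInterval).map ((↑) : unitInterval → ℝ)
      = (volume : Measure ℝ).restrict (Set.Icc 0 1) := by
    rw [show (volume : Measure unitInterval) = (volume : Measure ℝ).comap (↑) from rfl,
      h.map_comap]
    congr 1
    exact Subtype.range_coe
  rw [setLIntegral_congr Ioo_ae_eq_Icc, ← h1, h.lintegral_map]
  exact lintegral_congr fun x => by rw [Set.projIcc_val]

variable {A : Type*} [MetricSpace A] [MeasurableSpace A] [BorelSpace A]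
  [SecondCountableTopology A]

/-- A measurable family of probability measures `p (b, ·) lam` concentrated near `b`, with densities
bounded below, together with a realization by functions of a uniform random variable. -/
lemma exists_markDensity [StandardBorelSpace A] (hρ : ∀ a b : A, dist a b < 1) (lam : Measure A)
    [IsFiniteMeasure lam] [lam.IsOpenPosMeasure] (a₀ : A) {ε : ℝ≥0} (hε : 0 < ε) :
    ∃ (p : A × A → ℝ≥0) (f : A × ℝ → A), Measurable p ∧ Measurable f ∧
      (∀ (b : A) (φ : A → ℝ≥0∞), Measurable φ →
        ∫⁻ u in Set.Ioo (0 : ℝ) 1, φ (f (b, u)) = ∫⁻ a, φ a * p (b, a) ∂lam) ∧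
      (∃ c : ℝ≥0, 0 < c ∧ ∀ q, c ≤ p q) ∧ (∀ b, ∃ C, ∀ a, p (b, a) ≤ C) ∧
      ∀ b, ∫⁻ a, ENNReal.ofReal (dist a b) * p (b, a) ∂lam ≤ ε := by
  have : Nonempty A := ⟨a₀⟩
  -- The ball part of the mixture costs at most its radius `R`, and the global part at most its
  -- weight `η`, as distances are below 1. The cap at 1 keeps `1 - η` a true subtraction.
  set R : ℝ≥0 := ε / 2 with hRdef
  have hR : 0 < R := half_pos hε
  set η : ℝ≥0 := min R 1 with hηdef
  have hη : 0 < η := lt_min hR one_pos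
  have hη1 : η ≤ 1 := min_le_right _ _
  let m : A → ℝ≥0 := fun b => (lam (Metric.ball b R)).toNNReal
  have hmE : ∀ b, (m b : ℝ≥0∞) = lam (Metric.ball b R) := fun b =>
    ENNReal.coe_toNNReal (measure_ne_top _ _)
  -- Full support makes every ball charged, so normalization is possible.
  have hm : ∀ b, 0 < m b := fun b => by
    rw [← ENNReal.coe_pos, hmE]
    exact Metric.measure_ball_pos lam b (by exact_mod_cast hR)
  let M : ℝ≥0 := (lam Set.univ).toNNReal
  have hME : (M : ℝ≥0∞) = lam Set.univ := ENNReal.coe_toNNReal (measure_ne_top _ _)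
  have hM : 0 < M := by
    rw [← ENNReal.coe_pos, hME]
    exact isOpen_univ.measure_pos lam Set.univ_nonempty
  have hSm : MeasurableSet {q : A × A | dist q.2 q.1 < R} :=
    measurableSet_lt (by fun_prop) measurable_const
  have hmm : Measurable m := (measurable_measure_prodMk_left (ν := lam) hSm).ennreal_toNNReal
  let p : A × A → ℝ≥0 := fun q =>
    {q : A × A | dist q.2 q.1 < R}.indicator (fun q => (1 - η) * (m q.1)⁻¹) q + η * M⁻¹
  have hp : Measurable p := by
    refine Measurable.add (Measurable.indicator ?_ hSm) measurable_const
    fun_prop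
  have hint : ∀ b (φ : A → ℝ≥0∞), Measurable φ → ∫⁻ a, φ a * p (b, a) ∂lam
      = ((1 - η : ℝ≥0) * (m b : ℝ≥0∞)⁻¹) * ∫⁻ a in Metric.ball b R, φ a ∂lam
        + (η * (M : ℝ≥0∞)⁻¹) * ∫⁻ a, φ a ∂lam := fun b φ hφ => by
    have e : ∀ a, φ a * p (b, a) = (Metric.ball b R).indicator
        (fun a => ((1 - η : ℝ≥0) * (m b : ℝ≥0∞)⁻¹) * φ a) a + (η * (M : ℝ≥0∞)⁻¹) * φ a := fun a => by
      by_cases h : dist a b < R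
      · rw [Set.indicator_of_mem (show a ∈ Metric.ball b R from h)]
        simp only [p]
        rw [Set.indicator_of_mem (show (b, a) ∈ {q : A × A | dist q.2 q.1 < R} from h)]
        rw [ENNReal.coe_add, ENNReal.coe_mul, ENNReal.coe_mul, ENNReal.coe_inv (hm b).ne',
          ENNReal.coe_inv hM.ne']
        ring
      · rw [Set.indicator_of_notMem (show a ∉ Metric.ball b R from h)]
        simp only [p]
        rw [Set.indicator_of_notMem (show (b, a) ∉ {q : A × A | dist q.2 q.1 < R} from h)]
        rw [zero_add, ENNReal.coe_mul, ENNReal.coe_inv hM.ne']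
        ring
    simp only [e]
    rw [lintegral_add_right _ (hφ.const_mul _), lintegral_const_mul _ hφ,
      lintegral_indicator Metric.isOpen_ball.measurableSet, lintegral_const_mul _ hφ]
  have hmass : ∀ b, ∫⁻ a, p (b, a) ∂lam = 1 := fun b => by
    have := hint b (fun _ => 1) measurable_const
    simp only [one_mul, lintegral_const, Measure.restrict_apply MeasurableSet.univ,
      Set.univ_inter, ← hmE, ← hME] at this
    rw [this, mul_assoc, mul_assoc, ENNReal.inv_mul_cancel (by exact_mod_cast (hm b).ne')
      ENNReal.coe_ne_top, ENNReal.inv_mul_cancel (by exact_mod_cast hM.ne') ENNReal.coe_ne_top,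
      mul_one, mul_one, ← ENNReal.coe_add, tsub_add_cancel_of_le hη1, ENNReal.coe_one]
  let κ : Kernel A A := (Kernel.const A lam).withDensity fun b a => p (b, a)
  have hκ : ∀ b, κ b = lam.withDensity fun a => p (b, a) := fun b => by
    rw [Kernel.withDensity_apply _ (by fun_prop), Kernel.const_apply]
  have : IsMarkovKernel κ := ⟨fun b => ⟨by
    rw [hκ, withDensity_apply _ MeasurableSet.univ, Measure.restrict_univ, hmass]⟩⟩
  -- A Markov kernel into a standard Borel space is realized by a measurable function of a uniform
  -- variable.
  obtain ⟨f, hf, hfκ⟩ := κ.exists_measurable_map_eq_unitInterval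
  refine ⟨p, fun q => f q.1 (Set.projIcc 0 1 zero_le_one q.2), hp, ?_, ?_, ?_, ?_, ?_⟩
  · have h1 : Measurable fun q : A × ℝ => (q.1, Set.projIcc (0 : ℝ) 1 zero_le_one q.2) :=
      measurable_fst.prodMk (continuous_projIcc.measurable.comp measurable_snd)
    exact hf.comp h1
  · intro b φ hφ
    have hfb : Measurable (f b) := hf.of_uncurry_left
    rw [lintegral_Ioo_projIcc fun x => φ (f b x), ← lintegral_map hφ hfb, hfκ, hκ,
      lintegral_withDensity_eq_lintegral_mul _ (by fun_prop) hφ]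
    exact lintegral_congr fun a => mul_comm _ _
  · exact ⟨η * M⁻¹, mul_pos hη (inv_pos.2 hM), fun q => le_add_self⟩
  -- The bound depends on `b` through the mass of its ball, hence the need for finitely many values
  -- of `β`.
  · refine fun b => ⟨(1 - η) * (m b)⁻¹ + η * M⁻¹, fun a => add_le_add_left ?_ _⟩
    exact Set.indicator_le_self' (fun _ _ => zero_le) _
  · intro b
    rw [hint b _ (by fun_prop)]
    have h1 : ∫⁻ a in Metric.ball b R, ENNReal.ofReal (dist a b) ∂lam ≤ R * m b := by
      refine (setLIntegral_mono measurable_const (g := fun _ => (R : ℝ≥0∞)) fun a ha => ?_).trans ?_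
      · rw [← ENNReal.ofReal_coe_nnreal]
        exact ENNReal.ofReal_le_ofReal (le_of_lt ha)
      · rw [setLIntegral_const, hmE]
    have h2 : ∫⁻ a, ENNReal.ofReal (dist a b) ∂lam ≤ M := by
      refine (lintegral_mono (g := fun _ => 1) fun a => ENNReal.ofReal_le_one.2 (hρ _ _).le).trans ?_
      rw [lintegral_const, one_mul, hME]
    calc _ ≤ (1 * (m b : ℝ≥0∞)⁻¹) * (R * m b) + (η * (M : ℝ≥0∞)⁻¹) * M := by
          gcongr
          exact_mod_cast tsub_le_self
      _ = R * ((m b : ℝ≥0∞)⁻¹ * m b) + η * ((M : ℝ≥0∞)⁻¹ * M) := by ring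
      _ = R + η := by
          rw [ENNReal.inv_mul_cancel (by exact_mod_cast (hm b).ne') ENNReal.coe_ne_top,
            ENNReal.inv_mul_cancel (by exact_mod_cast hM.ne') ENNReal.coe_ne_top, mul_one, mul_one]
      _ ≤ R + R := by gcongr; exact_mod_cast min_le_left _ _
      _ = ε := by rw [← ENNReal.coe_add, hRdef, add_halves]

end MarkDensity

/-! ### Empty intervals become improbable when arrivals are sped up. -/

section NoArrival

variable {Ω' : Type*} [MeasurableSpace Ω']

/-- The event that no arrival time lies in `(u, t]`. -/
def noArrival (g : ℕ → Ω' → ℝ≥0) (u t : ℝ≥0) : Set Ω' :=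
  {ω | ∀ n, ¬(u < ∑ j ∈ Finset.range (n + 1), g j ω ∧ ∑ j ∈ Finset.range (n + 1), g j ω ≤ t)}

lemma measurableSet_noArrival {g : ℕ → Ω' → ℝ≥0} (hg : ∀ n, Measurable (g n)) {τ : ℝ≥0 → ℝ≥0}
    (hτ : Measurable τ) : MeasurableSet {q : Ω' × ℝ≥0 | q.1 ∈ noArrival g (τ q.2) q.2} := by
  have : {q : Ω' × ℝ≥0 | q.1 ∈ noArrival g (τ q.2) q.2}
      = ⋂ n, ({q | τ q.2 < ∑ j ∈ Finset.range (n + 1), g j q.1} ∩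
        {q | ∑ j ∈ Finset.range (n + 1), g j q.1 ≤ q.2})ᶜ := by
    ext q
    simp [noArrival]
  rw [this]
  exact MeasurableSet.iInter fun n => ((measurableSet_lt (by fun_prop) (by fun_prop)).inter
    (measurableSet_le (by fun_prop) (by fun_prop))).compl

/-- With `θ` the midpoint of the interval, the index near `θ / μ * (k + 1)` has rescaled arrival
time tending to `θ`. -/
lemma eventually_exists_mem_Ioc_of_tendsto_div {S : ℕ → ℝ} {μ : ℝ} (hμ : 0 < μ)
    (hS : Tendsto (fun n : ℕ => S n / n) atTop (𝓝 μ)) {u t : ℝ} (hu : 0 ≤ u) (hut : u < t) :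
    ∀ᶠ k : ℕ in atTop, ∃ n, u < 1 / ((k : ℝ) + 1) * S (n + 1) ∧ 1 / ((k : ℝ) + 1) * S (n + 1) ≤ t := by
  set θ : ℝ := (u + t) / 2 with hθ
  have hθ0 : 0 < θ := by linarith
  let N : ℕ → ℕ := fun k => ⌊θ / μ * ((k : ℝ) + 1)⌋₊
  have hk : Tendsto (fun k : ℕ => (k : ℝ) + 1) atTop atTop :=
    tendsto_atTop_add_const_right _ _ tendsto_natCast_atTop_atTop
  have hN : Tendsto (fun k : ℕ => (N k : ℝ) / ((k : ℝ) + 1)) atTop (𝓝 (θ / μ)) :=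
    (tendsto_nat_floor_mul_div_atTop (div_pos hθ0 hμ).le).comp hk
  have hN1 : Tendsto (fun k : ℕ => ((N k + 1 : ℕ) : ℝ) / ((k : ℝ) + 1)) atTop (𝓝 (θ / μ)) := by
    have := hN.add tendsto_one_div_add_atTop_nhds_zero_nat
    simp only [add_zero] at this
    refine this.congr fun k => ?_
    push_cast
    rw [add_div]
  have hNtop : Tendsto (fun k => N k + 1) atTop atTop := by
    have h1 : Tendsto N atTop atTop :=
      tendsto_nat_floor_atTop.comp (hk.const_mul_atTop (div_pos hθ0 hμ))
    exact (tendsto_add_atTop_nat 1).comp h1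
  have hlim : Tendsto (fun k : ℕ => 1 / ((k : ℝ) + 1) * S (N k + 1)) atTop (𝓝 θ) := by
    have h1 := (hS.comp hNtop).mul hN1
    rw [mul_div_cancel₀ _ hμ.ne'] at h1
    refine h1.congr fun k => ?_
    have h2 : ((N k + 1 : ℕ) : ℝ) ≠ 0 := by positivity
    simp only [Function.comp_apply]
    field_simp
  filter_upwards [hlim.eventually (Ioo_mem_nhds (show u < θ by linarith) (show θ < t by linarith))]
    with k hk
  exact ⟨N k, hk.1, hk.2.le⟩

/-- Speeding up an exponential renewal process makes empty intervals improbable. -/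
lemma tendsto_lintegral_noArrival {P' : Measure Ω'} [IsProbabilityMeasure P'] {r : ℝ} (hr : 0 < r)
    {x : ℕ → Ω' → ℝ≥0} (hx : ∀ n, Measurable (x n)) (hpos : ∀ n ω, 0 < x n ω)
    (hlaw : ∀ n, HasLaw (fun ω => (x n ω : ℝ)) (expMeasure r) P')
    (hind : iIndepFun x P') {τ : ℝ≥0 → ℝ≥0} (hτ : Measurable τ) (hτlt : ∀ t, 0 < t → τ t < t)
    (T : ℝ≥0) :
    Tendsto (fun k : ℕ => ∫⁻ t in Set.Iic T,
      P' (noArrival (fun n ω => (1 / ((k : ℝ≥0) + 1)) * x n ω) (τ t) t) ∂timeMeasure)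
      atTop (𝓝 0) := by
  have hxr : ∀ n, Measurable fun ω => (x n ω : ℝ) := fun n => (hx n).coe_nnreal_real
  have hint : Integrable (fun ω => (x 0 ω : ℝ)) P' := by
    have := integrable_id_expMeasure hr
    rw [← (hlaw 0).map_eq] at this
    exact this.comp_aemeasurable (hxr 0).aemeasurable
  have hmean : 0 < ∫ ω, (x 0 ω : ℝ) ∂P' := by
    rw [integral_pos_iff_support_of_nonneg (fun ω => (x 0 ω).coe_nonneg) hint]
    have : Function.support (fun ω => (x 0 ω : ℝ)) = Set.univ :=
      Set.eq_univ_of_forall fun ω => by simpa using (hpos 0 ω).ne'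
    simp [this]
  -- The strong law supplies the limit of partial sums divided by `n`; two dominated convergences
  -- then pass it to the probability and to the time integral.
  have hlln : ∀ᵐ ω ∂P', Tendsto (fun n : ℕ => (∑ i ∈ Finset.range n, (x i ω : ℝ)) / n) atTop
      (𝓝 (∫ ω, (x 0 ω : ℝ) ∂P')) := by
    refine strong_law_ae_real (fun n ω => (x n ω : ℝ)) hint (fun i j hij => ?_) fun i => ?_
    · exact (hind.indepFun hij).comp measurable_coe_nnreal_real measurable_coe_nnreal_real
    · exact ⟨(hxr i).aemeasurable, (hxr 0).aemeasurable, by rw [(hlaw i).map_eq, (hlaw 0).map_eq]⟩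
  have hgm : ∀ k : ℕ, ∀ n, Measurable fun ω => (1 / ((k : ℝ≥0) + 1)) * x n ω := fun k n =>
    (hx n).const_mul _
  rw [← lintegral_zero (μ := timeMeasure.restrict (Set.Iic T))]
  refine tendsto_lintegral_of_dominated_convergence (fun _ => 1) (fun k => ?_)
    (fun k => ae_of_all _ fun t => prob_le_one) ?_ ?_
  · exact measurable_measure_prodMk_right (measurableSet_noArrival (hgm k) hτ)
  · simp [timeMeasure_Iic]
  · refine ae_restrict_of_ae ?_
    -- Time zero, where `τ t < t` is not available, is null.
    filter_upwards [measure_eq_zero_iff_ae_notMem.1 (measure_singleton (μ := timeMeasure) 0)] with t ht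
    have ht0 : 0 < t := pos_iff_ne_zero.2 ht
    have hms : ∀ k : ℕ, MeasurableSet
        (noArrival (fun n ω => (1 / ((k : ℝ≥0) + 1)) * x n ω) (τ t) t) := fun k =>
      (measurableSet_noArrival (hgm k) hτ).preimage measurable_prodMk_right
    have h1 : ∀ k : ℕ, P' (noArrival (fun n ω => (1 / ((k : ℝ≥0) + 1)) * x n ω) (τ t) t)
        = ∫⁻ ω, (noArrival (fun n ω => (1 / ((k : ℝ≥0) + 1)) * x n ω) (τ t) t).indicator 1 ω ∂P' :=
      fun k => (lintegral_indicator_one (hms k)).symm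
    simp only [h1]
    rw [← lintegral_zero (μ := P')]
    refine tendsto_lintegral_of_dominated_convergence (fun _ => 1)
      (fun k => measurable_one.indicator (hms k))
      (fun k => ae_of_all _ fun ω => Set.indicator_le_self' (fun _ _ => zero_le) _) (by simp) ?_
    filter_upwards [hlln] with ω hω
    refine tendsto_const_nhds.congr' ?_
    filter_upwards [eventually_exists_mem_Ioc_of_tendsto_div hmean hω (τ t).coe_nonneg
      (NNReal.coe_lt_coe.2 (hτlt t ht0))] with k hk
    obtain ⟨n, hn1, hn2⟩ := hk
    refine (Set.indicator_of_notMem (fun h : ω ∈ noArrival _ _ _ => h n ?_) _).symm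
    rw [← Finset.mul_sum, ← NNReal.coe_lt_coe, ← NNReal.coe_le_coe]
    push_cast
    exact ⟨hn1, hn2⟩

end NoArrival

/-! ### Distance between the marked path and the step process. -/

section ErrorEstimate

variable {Ω Ω' A : Type*} [mΩ : MeasurableSpace Ω] [MeasurableSpace Ω'] [MetricSpace A]
  [MeasurableSpace A] {g : ℕ → Ω' → ℝ≥0} {U : ℕ → Ω' → ℝ} {β : ℝ≥0 × Ω → A} {f : A × ℝ → A}

/-- If some arrival lies in `(τ t, t]`, so does the last one before `t`; `β` has not changed since,
so the current mark was drawn from the law attached to `β (t, ω)`. Otherwise the distance is bounded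
by 1. -/
lemma dist_stepPath_renewalMarked_le (hρ : ∀ a b : A, dist a b < 1) (a₀ : A)
    (hg : ∀ n, Measurable (g n)) (hpos : ∀ n ω, 0 < g n ω)
    (hlim : ∀ ω, Tendsto (fun n => ∑ j ∈ Finset.range n, g j ω) atTop atTop)
    (hU : ∀ n, Measurable (U n)) (hβ : Measurable β) (hf : Measurable f)
    {τ : ℝ≥0 → ℝ≥0} (hβτ : ∀ t s ω, τ t < s → s ≤ t → β (s, ω) = β (t, ω))
    (t : ℝ≥0) (ω : Ω) (ω' : Ω') :
    ENNReal.ofReal (dist ((renewalMarked hg hpos hlim hU hβ hf).stepPath a₀ t (ω, ω')) (β (t, ω)))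
      ≤ (noArrival g (τ t) t).indicator 1 ω' + ∑' n,
        {ω' | ∑ j ∈ Finset.range (n + 1), g j ω' ≤ t ∧
          t < ∑ j ∈ Finset.range (n + 1 + 1), g j ω'}.indicator 1 ω' *
        ENNReal.ofReal (dist (f (β (t, ω), U n ω')) (β (t, ω))) := by
  set N := renewalMarked hg hpos hlim hU hβ hf with hN
  by_cases hb : ω' ∈ noArrival g (τ t) t
  · rw [Set.indicator_of_mem hb]
    exact (ENNReal.ofReal_le_one.2 (hρ _ _).le).trans le_self_add
  · simp only [noArrival, Set.mem_ofPred_eq, not_forall, not_not] at hb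
    obtain ⟨k, hk1, hk2⟩ := hb
    obtain ⟨m, hm⟩ := N.exists_time_le_iff (ω, ω') t
    obtain ⟨n, rfl⟩ : ∃ n, m = n + 1 := ⟨m - 1, by have := (hm k).1 hk2; omega⟩
    have h1 : N.time n (ω, ω') ≤ t := (hm n).2 n.lt_succ_self
    have h2 : t < N.time (n + 1) (ω, ω') := not_le.1 fun h => lt_irrefl _ ((hm _).1 h)
    have h3 : τ t < N.time n (ω, ω') :=
      hk1.trans_le ((N.strictMono_time (ω, ω')).monotone (Nat.lt_succ_iff.1 ((hm k).1 hk2)))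
    have h4 : N.stepPath a₀ t (ω, ω') = f (β (t, ω), U n ω') := by
      rw [N.stepPath_of_mem a₀ ⟨h1, h2⟩, ← hβτ t _ ω h3 h1]
      rfl
    rw [h4]
    refine le_trans ?_ ((ENNReal.le_tsum n).trans le_add_self)
    rw [Set.indicator_of_mem, Pi.one_apply, one_mul]
    exact ⟨h1, h2⟩

/-- The event that arrival `n` is the last one up to `t` depends only on the gaps, including the
next one, hence is independent of `U n`. These events are disjoint, so the mean mark errors add up
to at most `ε`. -/
lemma krylovDist_stepPath_renewalMarked_le [BorelSpace A] [SecondCountableTopology A]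
    (hρ : ∀ a b : A, dist a b < 1) (a₀ : A)
    (P : Measure Ω) [IsProbabilityMeasure P] (P' : Measure Ω') [IsProbabilityMeasure P']
    (hg : ∀ n, Measurable (g n)) (hpos : ∀ n ω, 0 < g n ω)
    (hlim : ∀ ω, Tendsto (fun n => ∑ j ∈ Finset.range n, g j ω) atTop atTop)
    (hU : ∀ n, Measurable (U n)) (hβ : Measurable β) (hf : Measurable f)
    {τ : ℝ≥0 → ℝ≥0} (hτ : Measurable τ)
    (hβτ : ∀ t s ω, τ t < s → s ≤ t → β (s, ω) = β (t, ω))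
    (hgU : ∀ n, IndepFun (fun ω n => g n ω) (U n) P') {ε : ℝ≥0∞}
    (herr : ∀ n b, ∫⁻ ω, ENNReal.ofReal (dist (f (b, U n ω)) b) ∂P' ≤ ε) (T : ℝ≥0) :
    krylovDist (P.prod P') T ((renewalMarked hg hpos hlim hU hβ hf).stepPath a₀)
        (fun t ω => β (t, ω.1))
      ≤ ∫⁻ t in Set.Iic T, (P' (noArrival g (τ t) t) + ε) ∂timeMeasure := by
  let E : ℕ → ℝ≥0 → Set Ω' := fun n t => {ω' | ∑ j ∈ Finset.range (n + 1), g j ω' ≤ t ∧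
    t < ∑ j ∈ Finset.range (n + 1 + 1), g j ω'}
  let ψ : (Ω × ℝ≥0) × Ω' → ℝ≥0∞ := fun q => (noArrival g (τ q.1.2) q.1.2).indicator 1 q.2 +
    ∑' n, (E n q.1.2).indicator 1 q.2 *
      ENNReal.ofReal (dist (f (β (q.1.2, q.1.1), U n q.2)) (β (q.1.2, q.1.1)))
  have hEm : ∀ n, MeasurableSet {q : ℝ≥0 × Ω' | q.2 ∈ E n q.1} := fun n =>
    (measurableSet_le (by fun_prop) (by fun_prop)).inter
      (measurableSet_lt (by fun_prop) (by fun_prop))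
  have hψ : Measurable ψ := by
    refine Measurable.add ?_ (Measurable.tsum fun n => Measurable.mul ?_ (by fun_prop))
    · exact (measurable_one.indicator (measurableSet_noArrival hg hτ)).comp
        (show Measurable fun q : (Ω × ℝ≥0) × Ω' => (q.2, q.1.2) by fun_prop)
    · exact (measurable_one.indicator (hEm n)).comp
        (show Measurable fun q : (Ω × ℝ≥0) × Ω' => (q.1.2, q.2) by fun_prop)
  have hnm : ∀ t, MeasurableSet (noArrival g (τ t) t) := fun t =>
    (measurableSet_noArrival hg hτ).preimage measurable_prodMk_right
  have hEm' : ∀ n t, MeasurableSet (E n t) := fun n t => (hEm n).preimage measurable_prodMk_left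
  have hinner : ∀ ω t, ∫⁻ ω', ψ ((ω, t), ω') ∂P' ≤ P' (noArrival g (τ t) t) + ε := by
    intro ω t
    simp only [ψ]
    rw [lintegral_add_left (measurable_one.indicator (hnm t)), lintegral_indicator_one (hnm t)]
    refine add_le_add_right ?_ _
    have hUm : ∀ n, Measurable fun ω' =>
        ENNReal.ofReal (dist (f (β (t, ω), U n ω')) (β (t, ω))) := fun n => by fun_prop
    have hprod : ∀ n, Measurable fun ω' => (E n t).indicator (1 : Ω' → ℝ≥0∞) ω' *
        ENNReal.ofReal (dist (f (β (t, ω), U n ω')) (β (t, ω))) := fun n =>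
      (measurable_one.indicator (hEm' n t)).mul (hUm n)
    rw [lintegral_tsum fun n => (hprod n).aemeasurable]
    have hterm : ∀ n, ∫⁻ ω', (E n t).indicator 1 ω' *
        ENNReal.ofReal (dist (f (β (t, ω), U n ω')) (β (t, ω))) ∂P' ≤ P' (E n t) * ε := fun n => by
      have hindep : IndepFun ((E n t).indicator (1 : Ω' → ℝ≥0∞))
          (fun ω' => ENNReal.ofReal (dist (f (β (t, ω), U n ω')) (β (t, ω)))) P' := by
        have hφ : Measurable ({x : ℕ → ℝ≥0 | ∑ j ∈ Finset.range (n + 1), x j ≤ t} ∩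
            {x : ℕ → ℝ≥0 | t < ∑ j ∈ Finset.range (n + 1 + 1), x j} |>.indicator
              (1 : (ℕ → ℝ≥0) → ℝ≥0∞)) :=
          measurable_one.indicator ((measurableSet_le (by fun_prop) (by fun_prop)).inter
            (measurableSet_lt (by fun_prop) (by fun_prop)))
        exact (hgU n).comp hφ (show Measurable fun u => ENNReal.ofReal
          (dist (f (β (t, ω), u)) (β (t, ω))) by fun_prop)
      have h1 := lintegral_mul_eq_lintegral_mul_lintegral_of_indepFun
        (measurable_one.indicator (hEm' n t)) (hUm n) hindep
      simp only [Pi.mul_apply] at h1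
      rw [h1, lintegral_indicator_one (hEm' n t)]
      gcongr
      exact herr n _
    refine (ENNReal.tsum_le_tsum hterm).trans ?_
    rw [ENNReal.tsum_mul_right]
    refine mul_le_of_le_one_left' ?_
    rw [← measure_iUnion _ (hEm' · t)]
    · exact prob_le_one
    · intro m n hmn
      refine Set.disjoint_left.2 fun ω' h1 h2 => ?_
      have hmono : Monotone fun n => ∑ j ∈ Finset.range n, g j ω' :=
        monotone_nat_of_le_succ fun n => by rw [Finset.sum_range_succ]; exact le_self_add
      rcases lt_or_gt_of_ne hmn with h | h
      · exact (h1.2.trans_le (hmono (show m + 1 + 1 ≤ n + 1 by omega))).not_ge h2.1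
      · exact (h2.2.trans_le (hmono (show n + 1 + 1 ≤ m + 1 by omega))).not_ge h1.1
  calc krylovDist (P.prod P') T _ _
      ≤ ∫⁻ ω, ∫⁻ t in Set.Iic T, ψ ((ω.1, t), ω.2) ∂timeMeasure ∂P.prod P' :=
        lintegral_mono fun ω => lintegral_mono fun t =>
          dist_stepPath_renewalMarked_le hρ a₀ hg hpos hlim hU hβ hf hβτ t ω.1 ω.2
    _ = ∫⁻ ω, ∫⁻ ω', ∫⁻ t in Set.Iic T, ψ ((ω, t), ω') ∂timeMeasure ∂P' ∂P := by
        refine lintegral_prod _ (Measurable.aemeasurable ?_)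
        exact Measurable.lintegral_prod_right'
          (f := fun q : (Ω × Ω') × ℝ≥0 => ψ ((q.1.1, q.2), q.1.2)) (by fun_prop)
    _ = ∫⁻ ω, ∫⁻ t in Set.Iic T, ∫⁻ ω', ψ ((ω, t), ω') ∂P' ∂timeMeasure ∂P :=
        lintegral_congr fun ω => lintegral_lintegral_swap
          (f := fun ω' t => ψ ((ω, t), ω')) (by
            refine Measurable.aemeasurable ?_
            exact hψ.comp (show Measurable fun q : Ω' × ℝ≥0 => ((ω, q.2), q.1) by fun_prop))
    _ ≤ ∫⁻ ω, ∫⁻ t in Set.Iic T, (P' (noArrival g (τ t) t) + ε) ∂timeMeasure ∂P :=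
        lintegral_mono fun ω => lintegral_mono fun t => hinner ω t
    _ = _ := by simp

end ErrorEstimate

/-! ### Consequences of the Borel space hypothesis. -/

lemma IsBorelTopologicalSpace.secondCountableTopology {A : Type*} [TopologicalSpace A]
    (hA : IsBorelTopologicalSpace A) : SecondCountableTopology A := by
  obtain ⟨X, _, _, f, hf, _⟩ := hA
  exact hf.secondCountableTopology

/-- The image, a Borel subset of a Polish space, has a Polish topology with the same Borel sets;
this topology is pulled back to `A`. The property is needed to realize the mark kernel by uniform
variables. -/
lemma IsBorelTopologicalSpace.standardBorelSpace {A : Type*} [TopologicalSpace A]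
    [MeasurableSpace A] [BorelSpace A] (hA : IsBorelTopologicalSpace A) :
    StandardBorelSpace A := by
  obtain ⟨X, _, _, f, hf, hr⟩ := hA
  let : MeasurableSpace X := borel X
  have : BorelSpace X := ⟨rfl⟩
  have hfm := hf.measurableEmbedding hr
  have : StandardBorelSpace (Set.range f) := hr.standardBorel
  obtain ⟨τ, hτ, hpol⟩ := StandardBorelSpace.polish (α := Set.range f)
  let e : A ≃ᵐ Set.range f := hfm.equivRange
  refine ⟨τ.induced e, @BorelSpace.mk _ (τ.induced e) _ ?_, e.toEquiv.polishSpace_induced⟩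
  rw [borel_comap, ← hτ.measurable_eq]
  exact e.measurableEmbedding.comap_eq.symm

/-! ### Triangle inequality for `krylovDist` and its invariance under extension of the space. -/

section KrylovDist

variable {Ω Ω' A : Type*} [MeasurableSpace Ω] [MeasurableSpace Ω'] [MetricSpace A]

lemma krylovDist_congr_right {P : Measure Ω} {T : ℝ≥0} {β γ γ' : ℝ≥0 → Ω → A}
    (h : ∀ t ≤ T, ∀ ω, γ t ω = γ' t ω) : krylovDist P T β γ = krylovDist P T β γ' :=
  lintegral_congr fun ω => setLIntegral_congr_fun measurableSet_Iic fun t ht => by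
    rw [h t ht]

variable [MeasurableSpace A] [BorelSpace A] [SecondCountableTopology A]

lemma krylovDist_triangle (P : Measure Ω) (T : ℝ≥0) (β : ℝ≥0 → Ω → A) {γ δ : ℝ≥0 × Ω → A}
    (hγ : Measurable γ) (hδ : Measurable δ) :
    krylovDist P T β (fun t ω => δ (t, ω)) ≤ krylovDist P T β (fun t ω => γ (t, ω))
      + krylovDist P T (fun t ω => γ (t, ω)) (fun t ω => δ (t, ω)) := by
  have hm : Measurable fun q : Ω × ℝ≥0 =>
      ENNReal.ofReal (dist (γ (q.2, q.1)) (δ (q.2, q.1))) := by fun_prop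
  simp only [krylovDist]
  rw [← lintegral_add_right _ hm.lintegral_prod_right']
  refine lintegral_mono fun ω => ?_
  have hm' : Measurable fun t => ENNReal.ofReal (dist (γ (t, ω)) (δ (t, ω))) := by fun_prop
  rw [← lintegral_add_right _ hm']
  refine lintegral_mono fun t => ?_
  rw [← ENNReal.ofReal_add dist_nonneg dist_nonneg]
  exact ENNReal.ofReal_le_ofReal (dist_triangle _ _ _)

lemma krylovDist_prod (P : Measure Ω) [SFinite P] (P' : Measure Ω') [IsProbabilityMeasure P']
    (T : ℝ≥0) {γ δ : ℝ≥0 × Ω → A} (hγ : Measurable γ) (hδ : Measurable δ) :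
    krylovDist (P.prod P') T (fun t ω => γ (t, ω.1)) (fun t ω => δ (t, ω.1))
      = krylovDist P T (fun t ω => γ (t, ω)) (fun t ω => δ (t, ω)) := by
  have hm : Measurable fun q : Ω × ℝ≥0 =>
      ENNReal.ofReal (dist (γ (q.2, q.1)) (δ (q.2, q.1))) := by fun_prop
  have hm' : Measurable fun ω : Ω × Ω' => ∫⁻ t in Set.Iic T,
      ENNReal.ofReal (dist (γ (t, ω.1)) (δ (t, ω.1))) ∂timeMeasure :=
    hm.lintegral_prod_right'.comp measurable_fst
  simp only [krylovDist]
  rw [lintegral_prod _ hm'.aemeasurable]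
  simp

end KrylovDist

lemma measurable_predictable_extendFiltration {Ω Ω' : Type*} {mΩ : MeasurableSpace Ω}
    [MeasurableSpace Ω'] (G : Filtration ℝ≥0 mΩ) :
    Measurable[(extendFiltration Ω' G).predictable, G.predictable]
      fun q : ℝ≥0 × (Ω × Ω') => (q.1, q.2.1) := by
  rw [measurable_iff_comap_le, MeasurableSpace.comap_le_iff_le_map]
  refine measurableSpace_le_predictable_of_measurableSet (fun B hB => ?_) fun i B hB => ?_
  · exact measurableSet_predictable_singleton_bot_prod (𝓕 := extendFiltration Ω' G)
      (s := Prod.fst ⁻¹' B) ⟨B, hB, rfl⟩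
  · exact measurableSet_predictable_Ioi_prod (𝓕 := extendFiltration Ω' G)
      (s := Prod.fst ⁻¹' B) ⟨B, hB, rfl⟩

/-! ### Waiting times of the auxiliary Poisson process and their independence. -/

namespace MarkedPointProcess

variable {Ω A : Type*} [MeasurableSpace Ω] [MeasurableSpace A]

/-- The waiting times, as nonnegative reals. -/
def waiting (N : MarkedPointProcess Ω A) : ℕ → Ω → ℝ≥0
  | 0, ω => N.time 0 ω
  | n + 1, ω => N.time (n + 1) ω - N.time n ω

lemma measurable_waiting (N : MarkedPointProcess Ω A) (n : ℕ) : Measurable (N.waiting n) := by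
  cases n with
  | zero => exact N.measurable_time 0
  | succ n => exact (N.measurable_time (n + 1)).sub (N.measurable_time n)

lemma waiting_pos (N : MarkedPointProcess Ω A) (n : ℕ) (ω : Ω) : 0 < N.waiting n ω := by
  cases n with
  | zero => exact N.time_pos 0 ω
  | succ n => exact tsub_pos_of_lt (N.strictMono_time ω n.lt_succ_self)

lemma coe_waiting (N : MarkedPointProcess Ω A) (n : ℕ) (ω : Ω) :
    (N.waiting n ω : ℝ) = N.gap n ω := by
  cases n with
  | zero => rfl
  | succ n => exact NNReal.coe_sub (N.strictMono_time ω n.lt_succ_self).le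

lemma sum_waiting (N : MarkedPointProcess Ω A) (n : ℕ) (ω : Ω) :
    ∑ j ∈ Finset.range (n + 1), N.waiting j ω = N.time n ω := by
  induction n with
  | zero => simp [waiting]
  | succ n ih =>
    rw [Finset.sum_range_succ, ih]
    exact add_tsub_cancel_of_le (N.strictMono_time ω n.lt_succ_self).le

lemma tendsto_sum_const_mul_waiting (N : MarkedPointProcess Ω A) {c : ℝ≥0} (hc : 0 < c) (ω : Ω) :
    Tendsto (fun n => ∑ j ∈ Finset.range n, c * N.waiting j ω) atTop atTop := by
  rw [← tendsto_add_atTop_iff_nat 1]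
  simp only [← Finset.mul_sum, sum_waiting]
  exact (N.tendsto_time ω).const_mul_atTop hc

lemma measurable_sigmaAlgebra_waiting (N : MarkedPointProcess Ω A) (n : ℕ) :
    Measurable[N.sigmaAlgebra] (N.waiting n) := by
  have h : ∀ n, Measurable[N.sigmaAlgebra] (N.time n) := fun n =>
    measurable_iff_comap_le.2 (le_iSup_of_le n le_sup_left)
  cases n with
  | zero => exact h 0
  | succ n => exact (h (n + 1)).sub (h n)

end MarkedPointProcess

lemma AuxiliaryObjects.iIndepFun_U {Ω' A : Type*} [MeasurableSpace Ω'] [MeasurableSpace A]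
    {lam : Measure A} {P' : Measure Ω'} (aux : AuxiliaryObjects lam P') (m : ℕ) :
    iIndepFun (aux.U m) P' := by
  have hinj : Function.Injective
      (fun n : ℕ => (Sum.inl (m, n) : (ℕ × ℕ) ⊕ ((ℕ × ℕ) ⊕ ℕ))) := fun a b h => by
    simpa using h
  exact (iIndepFun_iff_iIndep _ _ _).2 (aux.indep.precomp hinj)

lemma AuxiliaryObjects.indepFun_waiting_U {Ω' A : Type*} [MeasurableSpace Ω'] [MeasurableSpace A]
    {lam : Measure A} {P' : Measure Ω'} (aux : AuxiliaryObjects lam P') (k m : ℕ) :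
    IndepFun (fun ω n => (aux.π k).waiting n ω) (fun ω n => aux.U m n ω) P' := by
  let S : Set ((ℕ × ℕ) ⊕ ((ℕ × ℕ) ⊕ ℕ)) := {Sum.inr (Sum.inr k)}
  let S' : Set ((ℕ × ℕ) ⊕ ((ℕ × ℕ) ⊕ ℕ)) := Set.range Sum.inl
  have hdisj : Disjoint S S' := by
    simp [S, S']
  have hle : ∀ i, Sum.elim
      (fun p : ℕ × ℕ => MeasurableSpace.comap (aux.U p.1 p.2) inferInstance)
      (Sum.elim (fun p : ℕ × ℕ => MeasurableSpace.comap (aux.V p.1 p.2) inferInstance)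
        (fun k : ℕ => (aux.π k).sigmaAlgebra)) i ≤ (inferInstance : MeasurableSpace Ω') := by
    rintro (p | p | j)
    · exact (aux.measurable_U _ _).comap_le
    · exact (aux.measurable_V _ _).comap_le
    · exact iSup_le fun n => sup_le ((aux.π j).measurable_time n).comap_le
        ((aux.π j).measurable_mark n).comap_le
  have h := indep_iSup_of_disjoint hle aux.indep hdisj
  rw [IndepFun_iff_Indep]
  refine indep_of_indep_of_le_left (indep_of_indep_of_le_right h ?_) ?_
  · refine measurable_iff_comap_le.1
      (@measurable_pi_lambda _ _ _ (_) _ _ fun n => measurable_iff_comap_le.2 ?_)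
    exact le_iSup₂_of_le (Sum.inl (m, n)) ⟨(m, n), rfl⟩ le_rfl
  · refine measurable_iff_comap_le.1 (@measurable_pi_lambda _ _ _ (_) _ _ fun n =>
      ((aux.π k).measurable_sigmaAlgebra_waiting n).mono ?_ le_rfl)
    exact le_iSup₂_of_le (Sum.inr (Sum.inr k)) rfl le_rfl

/-! ### Choice of parameters and assembly. -/

theorem mainTheorem7 {A Ω Ω' : Type*}
    -- `A` is a Borel space, and the metric `ρ = dist < 1` induces its topology
    [MetricSpace A] [MeasurableSpace A] [BorelSpace A]
    (hA : IsBorelTopologicalSpace A) (hρ : ∀ a b : A, dist a b < 1)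
    -- `lam` is a finite measure with full topological support
    (lam : Measure A) [IsFiniteMeasure lam] [lam.IsOpenPosMeasure] (a₀ : A)
    {mΩ : MeasurableSpace Ω} (P : Measure Ω) [IsProbabilityMeasure P] (G : Filtration ℝ≥0 mΩ)
    [MeasurableSpace Ω'] (P' : Measure Ω') [IsProbabilityMeasure P']
    (aux : AuxiliaryObjects lam P')
    (T : ℝ≥0) (hT : 0 < T) (α : ℝ≥0 → Ω → A) (hα : IsProgressiveUpTo G T α)
    (δ : ℝ) (hδ : 0 < δ) :
    ∃ N : MarkedPointProcess (Ω × Ω') A,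
      N.IsAdaptedTo (extendFiltration Ω' G ⊔ N.naturalFiltration) ∧
      krylovDist (P.prod P') T (N.stepPath a₀) (fun t ω => α t ω.1) < ENNReal.ofReal δ ∧
      ∃ ν : ℝ≥0 → Ω × Ω' → A → ℝ≥0,
        Measurable[(extendFiltration Ω' G ⊔ N.naturalFiltration).predictable.prod inferInstance]
          (fun p : (ℝ≥0 × (Ω × Ω')) × A => ν p.1.1 p.1.2 p.2) ∧
        N.IsCompensator (extendFiltration Ω' G ⊔ N.naturalFiltration) (P.prod P')
          (fun ω => (timeMeasure.prod lam).withDensity fun x => (ν x.1 ω x.2 : ℝ≥0∞)) ∧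
        ∃ c C : ℝ≥0, 0 < c ∧ ∀ t ≤ T, ∀ (ω : Ω × Ω') (a : A), c ≤ ν t ω a ∧ ν t ω a ≤ C := by
  have := hA.secondCountableTopology
  have := hA.standardBorelSpace
  have : Nonempty A := ⟨a₀⟩
  lift δ to ℝ≥0 using hδ.le
  rw [ENNReal.ofReal_coe_nnreal]
  have hδ' : 0 < δ := by exact_mod_cast hδ
  -- the predictable step process and the marking densities
  obtain ⟨β, τ, hβ, hβfin, hτ, hτlt, hβτ, hβα⟩ := exists_predictable_step_approx hρ a₀ P G hα
    (ε := ((δ / 2 : ℝ≥0) : ℝ≥0∞)) (by exact_mod_cast half_pos hδ')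
  have hβm : Measurable β := hβ.mono (predictable_le_prod G) le_rfl
  -- The error budget is `δ / 2` for replacing `α` by `β`, `δ / 4` for the marks (spread over time
  -- `T`) and `δ / 4` for empty intervals.
  obtain ⟨p, f, hp, hf, hfp, ⟨c₀, hc₀, hpc⟩, hpC, hperr⟩ := exists_markDensity hρ lam a₀
    (ε := δ / 4 / T) (by positivity)
  -- the arrival times
  let x : ℕ → Ω' → ℝ≥0 := (aux.π 0).waiting
  have hx : ∀ n, Measurable (x n) := (aux.π 0).measurable_waiting
  let r₀ : ℝ≥0 := (lam Set.univ).toNNReal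
  have hr₀ : 0 < r₀ := ENNReal.toNNReal_pos
    (isOpen_univ.measure_pos lam Set.univ_nonempty).ne' (measure_ne_top _ _)
  have hxlaw : ∀ n, HasLaw (fun ω => (x n ω : ℝ)) (expMeasure r₀) P' := fun n => by
    have h := (aux.poisson_π 0).gap_law n
    -- Index 0 stands for `k = 1`, so the intensity is `lam` itself and the rate is its total mass.
    have h1 : ((((0 : ℕ) : ℝ≥0) + 1)⁻¹ • lam).real Set.univ = r₀ := by
      simp [r₀, Measure.real, ENNReal.toReal]
    rw [h1] at h
    have h2 : (fun ω => (x n ω : ℝ)) = (aux.π 0).gap n := funext fun ω => (aux.π 0).coe_waiting n ω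
    rwa [h2]
  have hxind : iIndepFun x P' := by
    have h := (aux.poisson_π 0).indep_gap.comp (fun _ => Real.toNNReal)
      fun _ => measurable_real_toNNReal
    have h2 : (fun n => Real.toNNReal ∘ (aux.π 0).gap n) = x := by
      ext n ω
      simp [x, ← MarkedPointProcess.coe_waiting]
    rwa [h2] at h
  obtain ⟨k, hk⟩ := ((tendsto_lintegral_noArrival (P' := P') (r := r₀) (by exact_mod_cast hr₀) hx
    (aux.π 0).waiting_pos hxlaw hxind hτ hτlt T).eventually_lt_const
      (show (0 : ℝ≥0∞) < ((δ / 4 : ℝ≥0) : ℝ≥0∞) by exact_mod_cast (by positivity))).exists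
  let c : ℝ≥0 := 1 / ((k : ℝ≥0) + 1)
  have hc : 0 < c := by positivity
  let g : ℕ → Ω' → ℝ≥0 := fun n ω => c * x n ω
  have hg : ∀ n, Measurable (g n) := fun n => (hx n).const_mul c
  have hgpos : ∀ n ω, 0 < g n ω := fun n ω => mul_pos hc ((aux.π 0).waiting_pos n ω)
  have hlim : ∀ ω, Tendsto (fun n => ∑ j ∈ Finset.range n, g j ω) atTop atTop :=
    (aux.π 0).tendsto_sum_const_mul_waiting hc
  have hU := aux.measurable_U 0
  have hgind : iIndepFun g P' := hxind.comp (fun _ y => c * y) fun _ => by fun_prop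
  have hgU : IndepFun (fun ω n => g n ω) (fun ω n => aux.U 0 n ω) P' :=
    (aux.indepFun_waiting_U 0 0).comp (φ := fun y n => c * y n) (by fun_prop) measurable_id
  have hlawU : ∀ n, ∀ (b : A) (φ : A → ℝ≥0∞), Measurable φ →
      ∫⁻ ω, φ (f (b, aux.U 0 n ω)) ∂P' = ∫⁻ a, φ a * p (b, a) ∂lam := fun n b φ hφ => by
    have hm : Measurable fun u => φ (f (b, u)) := by fun_prop
    rw [← hfp b φ hφ, ← (aux.law_U 0 n).map_eq, lintegral_map hm (hU n)]
  let N := renewalMarked hg hgpos hlim hU hβm hf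
  -- Multiplying exponential gaps by `c` divides their rate by `c`.
  let r : ℝ≥0 := r₀ / c
  have hr : 0 < r := div_pos hr₀ hc
  have hν : Measurable[(extendFiltration Ω' G ⊔ N.naturalFiltration).predictable.prod inferInstance]
      fun q : (ℝ≥0 × (Ω × Ω')) × A => r * p (β (q.1.1, q.1.2.1), q.2) := by
    let F := extendFiltration Ω' G ⊔ N.naturalFiltration
    have h1 : Measurable[F.predictable] fun q : ℝ≥0 × (Ω × Ω') => β (q.1, q.2.1) :=
      (hβ.comp (measurable_predictable_extendFiltration G)).mono (predictable_mono le_sup_left)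
        le_rfl
    let : MeasurableSpace (ℝ≥0 × (Ω × Ω')) := F.predictable
    exact (hp.comp ((h1.comp measurable_fst).prodMk measurable_snd)).const_mul r
  refine ⟨N, N.isAdaptedTo_of_le le_sup_right, ?_, fun t ω a => r * p (β (t, ω.1), a), hν, ?_, ?_⟩
  · obtain ⟨αe, hαe, hαeα⟩ := hα.exists_measurable_extension
    have h1 := krylovDist_stepPath_renewalMarked_le hρ a₀ P P' hg hgpos hlim hU hβm hf hτ hβτ
      (fun n => hgU.comp measurable_id (measurable_pi_apply n))
      (ε := ((δ / 4 / T : ℝ≥0) : ℝ≥0∞)) (fun n b => by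
        rw [hlawU n b (fun a => ENNReal.ofReal (dist a b)) (by fun_prop)]
        exact hperr b) T
    have h2 : krylovDist (P.prod P') T (N.stepPath a₀) (fun t ω => β (t, ω.1))
        < ((δ / 2 : ℝ≥0) : ℝ≥0∞) := by
      refine h1.trans_lt ?_
      rw [lintegral_add_right _ measurable_const, lintegral_const,
        Measure.restrict_apply MeasurableSet.univ, Set.univ_inter, timeMeasure_Iic,
        ← ENNReal.coe_mul, div_mul_cancel₀ _ hT.ne']
      refine (ENNReal.add_lt_add_right ENNReal.coe_ne_top hk).trans_eq ?_
      rw [← ENNReal.coe_add]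
      congr 1
      rw [← add_div, ← two_mul]
      norm_num [div_eq_mul_inv]
      ring_nf
    have hα1 : krylovDist P T (fun t ω => β (t, ω)) (fun t ω => αe (t, ω))
        < ((δ / 2 : ℝ≥0) : ℝ≥0∞) := by
      rwa [krylovDist_congr_right hαeα]
    rw [krylovDist_congr_right (γ' := fun t ω => αe (t, ω.1))
      fun t ht ω => (hαeα t ht ω.1).symm]
    refine (krylovDist_triangle _ T _ (γ := fun q : ℝ≥0 × (Ω × Ω') => β (q.1, q.2.1))
      (δ := fun q : ℝ≥0 × (Ω × Ω') => αe (q.1, q.2.1)) (by fun_prop) (by fun_prop)).trans_lt ?_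
    rw [krylovDist_prod P P' T hβm hαe]
    refine (ENNReal.add_lt_add h2 hα1).trans_eq ?_
    rw [← ENNReal.coe_add, add_halves]
  · exact isCompensator_renewalMarked hg hgpos hlim hU hβm hf G hp
      (indepFun_renewalPast hg hU hgind (aux.iIndepFun_U 0) hgU)
      (fun n => hgU.comp (measurable_pi_apply n) (measurable_pi_apply n))
      (fun n φ hφ => lintegral_const_mul_exponential hr₀ hc (hxlaw n) hφ) hlawU hν
  · choose C hC using hpC
    -- The pointwise bounds `C b` become one constant because `β` takes finitely many values.
    obtain ⟨C', hC'⟩ := (hβfin.image C).bddAbove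
    refine ⟨r * c₀, r * C', mul_pos hr hc₀, fun t _ ω a => ⟨?_, ?_⟩⟩
    · exact mul_le_mul_right (hpc _) r
    · exact mul_le_mul_right ((hC _ a).trans (hC' ⟨_, ⟨_, rfl⟩, rfl⟩)) r
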